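/- Let $A,B$ be finite-dimensional complex Hilbert spaces and let $\psi$ (the target) and $\varphi$ (the seed) be nonzero, possibly unnormalized, vectors in $A\otimes B$ with Schmidt decompositions $$\psi=\sum_{i=1}^{d}\sqrt{r_i}\,u_i\otimes v_i,\qquad \varphi=\sum_{i=1}^{d}\sqrt{t_i}\,u'_i\otimes v'_i,\qquad d=\min\{\dim A,\dim B\},$$ where $r_1\ge r_2\ge\dots\ge 0$ and $t_1\ge t_2\ge\dots\ge 0$ and the families $(u_i),(v_i),(u_i'),(v_i')$ are orthonormal. Let $\mathrm{SR}(\psi)=|\{i:r_i\neq 0\}|$ and $\mathrm{SR}(\varphi)=|\{i:t_i\neq 0\}|$ be the Schmidt ranks. For positive semidefinite operators let $F(R,S)=\big(\mathrm{Tr}\sqrt{\sqrt S R\sqrt S}\big)^2$. We write a vector for the corresponding rank-one operator, so $F(\psi,\cdot)$ means $F(|\psi\rangle\langle\psi|,\cdot)$. Let $$F_{\mathrm{LO}}(\psi,\varphi)=\max_{\mathcal E,\mathcal F}F\big(\psi,(\mathcal E\otimes\mathcal F)(|\varphi\rangle\langle\varphi|)\big),\qquad F_{\mathrm{LOSR}}(\psi,\varphi)=\max_{\mu,(\mathcal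 E_\lambda),(\mathcal F_\lambda)}F\Big(\psi,\int(\mathcal E_\lambda\otimes\mathcal F_\lambda)(|\varphi\rangle\langle\varphi|)\,d\mu(\lambda)\Big),$$ where $\mathcal E,\mathcal E_\lambda$ and $\mathcal F,\mathcal F_\lambda$ are quantum channels (completely positive trace-preserving maps) on $A$ and on $B$ respectively, $\mu$ is a probability measure, and the families of channels are measurable in $\lambda$. For a finite alphabet $\Sigma$ and a probability distribution $P'$ on $\Sigma$, let $(R\otimes P')^{\downarrow}$ be the diagonal operator whose entries are the numbers $r_iP'(s)$ ($1\le i\le d$, $s\in\Sigma$) in decreasing order, and let $T^{\downarrow}_{\mathrm{embed}}$ be the diagonal operator of the same size whose entries are the $t_i$ in decreasing order, padded by zeros. Then all the following maxima are attained and $$F_{\mathrm{LOSR}}(\psi,\varphi)=F_{\mathrm{LO}}(\psi,\varphi)=\max_{P'}F\big((R\otimes P')^{\downarrow},T^{\downarrow}_{\mathrm{embed}}\big),$$ where the maximum is over all probability distributions $P'$ on alphabets $\Sigma$ with $|\Sigma|\le \mathrm{SR}(\varphi)\cdot\mathrm{SR}(\psi)$; for every fixed alphabet with $|\Sigma|\ge\mathrm{SR}(\varphi)\cdot\mathrm{SR}(\psi)$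 the maximum over the distributions $P'$ on $\Sigma$ has the same value. Moreover, this value equals the best fidelity of a local-unitary conversion of $\varphi$ into $\psi\otimes\zeta$ for some ancilla state $\zeta$: $$F_{\mathrm{LO}}(\psi,\varphi)=\max_{\zeta,U,V}F\big(\psi\otimes\zeta,\ (U\otimes V)(\varphi\otimes|0\rangle_{E_1}|0\rangle_{E_2})\big),$$ where the maximum is over all nonzero finite-dimensional spaces $E_1,E_2$, unit vectors $\zeta\in E_1\otimes E_2$, and unitaries $U$ on $A\otimes E_1$ and $V$ on $B\otimes E_2$. -/

import Mathlib

open scoped Kronecker ComplexOrder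

noncomputable section

namespace LocalConversion

/-! Systems `A, B, …` are `EuclideanSpace ℂ a`, `EuclideanSpace ℂ b`, … for finite types
`a, b, …`; the tensor product `A ⊗ B` is `EuclideanSpace ℂ (a × b)`. -/

/-- The square root of a positive semidefinite matrix, through its spectral decomposition. -/
def psdSqrt {ι : Type*} [Fintype ι] [DecidableEq ι] (M : Matrix ι ι ℂ) : Matrix ι ι ℂ :=
  cfc Real.sqrt M

/-- The (squared) fidelity `F(R, S) = (Tr √(√S R √S))²` of positive semidefinite matrices. -/
def fidelity {ι : Type*} [Fintype ι] [DecidableEq ι] (R S : Matrix ι ι ℂ) : ℝ :=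
  ((psdSqrt (psdSqrt S * R * psdSqrt S)).trace.re) ^ 2

/-- The operator `|χ⟩⟨χ|`. -/
def pureOp {ι : Type*} (χ : EuclideanSpace ℂ ι) : Matrix ι ι ℂ :=
  Matrix.of fun x y => χ x * star (χ y)

/-- The product vector `u ⊗ v`. -/
def tensorVec {a b : Type*} (u : EuclideanSpace ℂ a) (v : EuclideanSpace ℂ b) :
    EuclideanSpace ℂ (a × b) :=
  WithLp.toLp 2 fun x => u x.1 * v x.2

/-- The tensor product `E ⊗ F` of two linear maps of matrix spaces, determined by
`(E ⊗ F)(X ⊗ Y) = E(X) ⊗ F(Y)` and evaluated by expanding in matrix units. -/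
def tensorMap {a b a' b' : Type*} [Fintype a] [DecidableEq a] [Fintype b] [DecidableEq b]
    (E : Matrix a a ℂ →ₗ[ℂ] Matrix a' a' ℂ) (F : Matrix b b ℂ →ₗ[ℂ] Matrix b' b' ℂ)
    (X : Matrix (a × b) (a × b) ℂ) : Matrix (a' × b') (a' × b') ℂ :=
  ∑ i, ∑ i', ∑ j, ∑ j',
    X (i, j) (i', j') • (E (Matrix.single i i' 1) ⊗ₖ F (Matrix.single j j' 1))

/-- A quantum channel: a completely positive and trace preserving linear map. -/
structure IsChannel {a a' : Type*} [Fintype a] [DecidableEq a] [Fintype a']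
    (E : Matrix a a ℂ →ₗ[ℂ] Matrix a' a' ℂ) : Prop where
  completely_positive : ∀ (k : ℕ) (X : Matrix (a × Fin k) (a × Fin k) ℂ), X.PosSemidef →
    (tensorMap E (LinearMap.id : Matrix (Fin k) (Fin k) ℂ →ₗ[ℂ] Matrix (Fin k) (Fin k) ℂ)
      X).PosSemidef
  trace_preserving : ∀ X : Matrix a a ℂ, (E X).trace = X.trace

section Conversion

variable {a b : Type*} [Fintype a] [DecidableEq a] [Fintype b] [DecidableEq b]

/-- The fidelities `F(ρ, (E ⊗ F)(σ))` achieved by local channels `E`, `F`. -/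
def fidelitiesLO (ρ σ : Matrix (a × b) (a × b) ℂ) : Set ℝ :=
  {x | ∃ (E : Matrix a a ℂ →ₗ[ℂ] Matrix a a ℂ) (F : Matrix b b ℂ →ₗ[ℂ] Matrix b b ℂ),
    IsChannel E ∧ IsChannel F ∧ x = fidelity ρ (tensorMap E F σ)}

/-- The fidelities `F(ρ, ∫ (E_s ⊗ F_s)(σ) dμ(s))` achieved by local channels `E_s`, `F_s` that
depend (measurably) on a shared random variable `s` of law `μ`. -/
def fidelitiesLOSR (ρ σ : Matrix (a × b) (a × b) ℂ) : Set ℝ :=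
  {x | ∃ (S : Type) (_ : MeasurableSpace S) (μ : MeasureTheory.Measure S)
      (E : S → Matrix a a ℂ →ₗ[ℂ] Matrix a a ℂ) (F : S → Matrix b b ℂ →ₗ[ℂ] Matrix b b ℂ),
    MeasureTheory.IsProbabilityMeasure μ ∧
    (∀ s, IsChannel (E s)) ∧ (∀ s, IsChannel (F s)) ∧
    (∀ X i j, Measurable fun s => E s X i j) ∧ (∀ X i j, Measurable fun s => F s X i j) ∧
    x = fidelity ρ (Matrix.of fun p q => ∫ s, tensorMap (E s) (F s) σ p q ∂μ)}

/-- The vector `ψ ⊗ ζ`, for `ψ ∈ A ⊗ B` and `ζ ∈ E₁ ⊗ E₂`, as a bipartite vector in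
`(A ⊗ E₁) ⊗ (B ⊗ E₂)`. -/
def withAncilla {e₁ e₂ : Type*} (ψ : EuclideanSpace ℂ (a × b))
    (ζ : EuclideanSpace ℂ (e₁ × e₂)) : EuclideanSpace ℂ ((a × e₁) × (b × e₂)) :=
  WithLp.toLp 2 fun x => ψ (x.1.1, x.2.1) * ζ (x.1.2, x.2.2)

/-- The fidelities between `ψ ⊗ ζ` and `(U ⊗ V)(φ ⊗ |0⟩|0⟩)`, for all ancilla spaces `E₁, E₂`,
pure ancilla states `ζ` and local unitaries `U` on `A ⊗ E₁`, `V` on `B ⊗ E₂`: the seed `φ` is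
embedded into the larger local spaces by means of `|0⟩|0⟩`. -/
def fidelitiesLUAncilla (ψ φ : EuclideanSpace ℂ (a × b)) : Set ℝ :=
  {x | ∃ (k l : ℕ) (ζ : EuclideanSpace ℂ (Fin (k + 1) × Fin (l + 1)))
      (U : Matrix (a × Fin (k + 1)) (a × Fin (k + 1)) ℂ)
      (V : Matrix (b × Fin (l + 1)) (b × Fin (l + 1)) ℂ),
    ‖ζ‖ = 1 ∧ U ∈ Matrix.unitaryGroup (a × Fin (k + 1)) ℂ ∧
    V ∈ Matrix.unitaryGroup (b × Fin (l + 1)) ℂ ∧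
    x = fidelity (pureOp (withAncilla ψ ζ))
      (pureOp (WithLp.toLp 2 ((U ⊗ₖ V).mulVec
        (withAncilla φ (EuclideanSpace.single ((0 : Fin (k + 1)), (0 : Fin (l + 1))) 1)).ofLp)))}

/-- `r` is the decreasing list of squared Schmidt coefficients of `ψ` (padded by zeros):
`ψ = ∑ √(rᵢ) uᵢ ⊗ vᵢ` with orthonormal `uᵢ` and orthonormal `vᵢ`. -/
structure IsSchmidt (ψ : EuclideanSpace ℂ (a × b))
    (r : Fin (min (Fintype.card a) (Fintype.card b)) → ℝ) : Prop where
  nonneg : ∀ i, 0 ≤ r i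
  antitone : Antitone r
  decomposition : ∃ (u : Fin (min (Fintype.card a) (Fintype.card b)) → EuclideanSpace ℂ a)
      (v : Fin (min (Fintype.card a) (Fintype.card b)) → EuclideanSpace ℂ b),
    Orthonormal ℂ u ∧ Orthonormal ℂ v ∧ ψ = ∑ i, (Real.sqrt (r i) : ℂ) • tensorVec (u i) (v i)

end Conversion

/-- The Schmidt rank: the number of nonzero Schmidt coefficients. -/
def schmidtRank {d : ℕ} (r : Fin d → ℝ) : ℕ := (Finset.univ.filter fun i => r i ≠ 0).card

/-- The decreasing rearrangement `p↓` of a finite family of real numbers. -/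
def sortDesc {ι : Type*} [Fintype ι] (p : ι → ℝ) : Fin (Fintype.card ι) → ℝ := fun i =>
  p ((Fintype.equivFin ι).symm (Tuple.sort (p ∘ (Fintype.equivFin ι).symm) (Fin.rev i)))

/-- The diagonal operator `∑ᵢ pᵢ |i⟩⟨i|`. -/
def diagOp {ι : Type*} [DecidableEq ι] (p : ι → ℝ) : Matrix ι ι ℂ :=
  Matrix.diagonal fun i => (p i : ℂ)

/-- The product `R ⊗ P'` over the joint alphabet. -/
def prodDist {ι κ : Type*} (r : ι → ℝ) (p : κ → ℝ) : ι × κ → ℝ := fun x => r x.1 * p x.2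

/-- The embedding of `T` into the joint alphabet: its entries are placed at the first letter of
the second alphabet and all remaining entries are zero. -/
def embedDist {d : ℕ} (t : Fin d → ℝ) (k : ℕ) : Fin d × Fin k → ℝ :=
  fun x => if (x.2 : ℕ) = 0 then t x.1 else 0

/-- The values `F((R ⊗ P')↓, T↓_embed)`, for probability distributions `P'` on an alphabet with
`k` letters. -/
def reorderedFidelities {d : ℕ} (r t : Fin d → ℝ) (k : ℕ) : Set ℝ :=
  {x | ∃ p ∈ stdSimplex ℝ (Fin k),
    x = fidelity (diagOp (sortDesc (prodDist r p))) (diagOp (sortDesc (embedDist t k)))}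

end LocalConversion

end

open LocalConversion

open LocalConversion
open scoped Kronecker ComplexOrder

noncomputable section

namespace LocalConversion

/-! ### Square roots and fidelities of pure and diagonal operators -/

section SquareRoot

variable {ι : Type*} [Fintype ι] [DecidableEq ι]

/-! For a pure target the fidelity is the expectation value `⟨ψ|S|ψ⟩`, which is linear in `S`.
Shared randomness therefore only averages local fidelities and cannot beat the best of them.

Write local channels through isometries `W`, `V` with Kraus operators `Kₛ`, `Lₙ`. The fidelity is
then `‖c‖²`, where `c` collects the amplitudes `⟨ψ|Kₛ ⊗ Lₙ|φ⟩`. Moreover `⟨ζ, c⟩ = ⟨ψ ⊗ ζ, (W ⊗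
V)φ⟩` (`inner_withAncilla_act`), and `‖c‖` is the maximum of `|⟨ζ, c⟩|` over unit `ζ`, so local
channels and local unitaries with an ancilla solve the same problem.

If `ζ` has squared Schmidt coefficients `p`, this overlap compares a vector with coefficients `r ⊗
p` to one with coefficients `t`. Von Neumann's trace inequality (`exists_matching_norm_sum_le`)
bounds it by the weight of a matching between the two lists, and the rearrangement inequality makes
sorted order the best matching. Conversely, unitaries that align the Schmidt bases realise any
permutation (`permOverlap_sq_mem_fidelitiesLUAncilla`).

A matching uses at most `SR(φ)` nonzero `tⱼ`, hence at most `SR(φ)` letters, so the optimum is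
already reached on that many letters (`exists_reordered_maximum`). This is at most `SR(φ) · SR(ψ)`,
since `ψ ≠ 0`. -/

theorem psdSqrt_eq_of_mul_self {M N : Matrix ι ι ℂ} (hN : N.PosSemidef) (h : N * N = M) :
    psdSqrt M = N := by
  have hsa : IsSelfAdjoint N := hN.isHermitian
  have hM : M = cfc (fun x : ℝ => x * x) N := by
    rw [cfc_mul (fun x : ℝ => x) (fun x : ℝ => x) N, cfc_id' ℝ N hsa, h]
  unfold psdSqrt
  rw [hM, ← cfc_comp' Real.sqrt (fun x : ℝ => x * x) N]
  conv_rhs => rw [← cfc_id' ℝ N hsa]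
  apply cfc_congr
  intro x hx
  rw [hN.isHermitian.spectrum_real_eq_range_eigenvalues] at hx
  obtain ⟨i, rfl⟩ := hx
  exact Real.sqrt_mul_self (hN.eigenvalues_nonneg i)

theorem psdSqrt_isHermitian (M : Matrix ι ι ℂ) : (psdSqrt M).IsHermitian :=
  cfc_predicate Real.sqrt M

theorem psdSqrt_mul_self {M : Matrix ι ι ℂ} (hM : M.PosSemidef) :
    psdSqrt M * psdSqrt M = M := by
  have hsa : IsSelfAdjoint M := hM.isHermitian
  unfold psdSqrt
  rw [← cfc_mul Real.sqrt Real.sqrt M (Real.continuous_sqrt.continuousOn)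
    (Real.continuous_sqrt.continuousOn)]
  conv_rhs => rw [← cfc_id' ℝ M hsa]
  apply cfc_congr
  intro x hx
  rw [hM.isHermitian.spectrum_real_eq_range_eigenvalues] at hx
  obtain ⟨i, rfl⟩ := hx
  exact Real.mul_self_sqrt (hM.eigenvalues_nonneg i)

omit [Fintype ι] [DecidableEq ι] in
theorem pureOp_eq_vecMulVec (χ : EuclideanSpace ℂ ι) :
    pureOp χ = Matrix.vecMulVec χ.ofLp (star χ.ofLp) := rfl

omit [DecidableEq ι] in
theorem pureOp_posSemidef (χ : EuclideanSpace ℂ ι) : (pureOp χ).PosSemidef :=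
  Matrix.posSemidef_vecMulVec_self_star _

omit [DecidableEq ι] in
theorem star_dotProduct_self_eq_norm_sq (χ : EuclideanSpace ℂ ι) :
    star χ.ofLp ⬝ᵥ χ.ofLp = ((‖χ‖ ^ 2 : ℝ) : ℂ) := by
  rw [dotProduct_comm, ← EuclideanSpace.inner_eq_star_dotProduct, inner_self_eq_norm_sq_to_K]
  norm_cast

theorem trace_psdSqrt_pureOp (χ : EuclideanSpace ℂ ι) :
    (psdSqrt (pureOp χ)).trace = (‖χ‖ : ℂ) := by
  by_cases h : χ = 0
  · subst h
    rw [psdSqrt_eq_of_mul_self (N := 0) Matrix.PosSemidef.zero]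
    · simp
    · ext i j; simp [pureOp]
  have hn : (‖χ‖ : ℂ) ≠ 0 := by simpa using h
  have hsq := star_dotProduct_self_eq_norm_sq χ
  -- Since `|χ⟩⟨χ|² = ‖χ‖² |χ⟩⟨χ|`, the root is `|χ⟩⟨χ| / ‖χ‖`.
  rw [psdSqrt_eq_of_mul_self (N := ((‖χ‖⁻¹ : ℝ) : ℂ) • pureOp χ)]
  · rw [Matrix.trace_smul, pureOp_eq_vecMulVec, Matrix.trace_vecMulVec, dotProduct_comm, hsq,
      smul_eq_mul]
    push_cast
    field_simp
  · exact (pureOp_posSemidef χ).smul (by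
      rw [Complex.zero_le_real]; positivity)
  · rw [Matrix.smul_mul, Matrix.mul_smul, smul_smul, pureOp_eq_vecMulVec,
      Matrix.vecMulVec_mul_vecMulVec, hsq]
    ext i j
    simp only [Matrix.smul_apply, Matrix.vecMulVec_apply, smul_eq_mul, Pi.smul_apply]
    push_cast
    field_simp

/-- The expectation value `⟨χ|S|χ⟩`. -/
def expVal (χ : EuclideanSpace ℂ ι) (S : Matrix ι ι ℂ) : ℝ :=
  (star χ.ofLp ⬝ᵥ S.mulVec χ.ofLp).re

/-- `√S|χ⟩⟨χ|√S` is the rank-one operator of `√S χ`, whose root has trace `‖√S χ‖`. The resulting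
linearity in `S` is what makes shared randomness useless. -/
theorem fidelity_pureOp {S : Matrix ι ι ℂ} (hS : S.PosSemidef) (χ : EuclideanSpace ℂ ι) :
    fidelity (pureOp χ) S = expVal χ S := by
  have hQ := psdSqrt_isHermitian S
  have h1 : psdSqrt S * pureOp χ * psdSqrt S
      = pureOp (WithLp.toLp 2 ((psdSqrt S).mulVec χ.ofLp)) := by
    rw [pureOp_eq_vecMulVec, pureOp_eq_vecMulVec, Matrix.mul_vecMulVec, Matrix.vecMulVec_mul]
    congr 1
    rw [Matrix.star_mulVec, hQ.eq]
  unfold fidelity expVal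
  rw [h1, trace_psdSqrt_pureOp, Complex.ofReal_re, ← Complex.ofReal_re (_ ^ 2),
    ← star_dotProduct_self_eq_norm_sq]
  simp only [Matrix.star_mulVec, hQ.eq]
  rw [← Matrix.dotProduct_mulVec, Matrix.mulVec_mulVec, psdSqrt_mul_self hS]

omit [DecidableEq ι] in
theorem expVal_pureOp (χ ω : EuclideanSpace ℂ ι) :
    expVal χ (pureOp ω) = ‖inner ℂ χ ω‖ ^ 2 := by
  unfold expVal
  rw [pureOp_eq_vecMulVec, Matrix.vecMulVec_mulVec, dotProduct_smul,
    EuclideanSpace.inner_eq_star_dotProduct, ← Complex.normSq_eq_norm_sq]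
  have : star ω.ofLp ⬝ᵥ χ.ofLp = star (star χ.ofLp ⬝ᵥ ω.ofLp) := by
    rw [Matrix.star_dotProduct]
  rw [this, dotProduct_comm ω.ofLp]
  simp [Complex.normSq_apply]

theorem fidelity_pureOp_pureOp (χ ω : EuclideanSpace ℂ ι) :
    fidelity (pureOp χ) (pureOp ω) = ‖inner ℂ χ ω‖ ^ 2 := by
  rw [fidelity_pureOp (pureOp_posSemidef ω), expVal_pureOp]

theorem psdSqrt_diagOp {p : ι → ℝ} (hp : ∀ i, 0 ≤ p i) :
    psdSqrt (diagOp p) = diagOp fun i => √(p i) := by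
  apply psdSqrt_eq_of_mul_self
  · refine Matrix.PosSemidef.diagonal fun i => ?_
    simp only [Pi.zero_apply, Complex.zero_le_real]
    positivity
  · unfold diagOp
    rw [Matrix.diagonal_mul_diagonal]
    congr 1
    ext i
    rw [← Complex.ofReal_mul, Real.mul_self_sqrt (hp i)]

theorem fidelity_diagOp {p q : ι → ℝ} (hp : ∀ i, 0 ≤ p i) (hq : ∀ i, 0 ≤ q i) :
    fidelity (diagOp p) (diagOp q) = (∑ i, √(p i) * √(q i)) ^ 2 := by
  have h : psdSqrt (diagOp q) * diagOp p * psdSqrt (diagOp q) = diagOp fun i => p i * q i := by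
    rw [psdSqrt_diagOp hq]
    unfold diagOp
    rw [Matrix.diagonal_mul_diagonal, Matrix.diagonal_mul_diagonal]
    congr 1
    ext i
    rw [← Complex.ofReal_mul, ← Complex.ofReal_mul, mul_right_comm, Real.mul_self_sqrt (hq i),
      mul_comm]
  unfold fidelity
  rw [h, psdSqrt_diagOp fun i => mul_nonneg (hp i) (hq i)]
  simp [diagOp, Matrix.trace_diagonal, Real.sqrt_mul, hp]

end SquareRoot

/-! ### Sorted overlaps and the attained maximum on the simplex -/

section Rearrangement

/-- The equivalence that lists a finite type in decreasing order of `p`. -/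
def sortDescEquiv {ι : Type*} [Fintype ι] (p : ι → ℝ) : Fin (Fintype.card ι) ≃ ι :=
  (Fin.revPerm.trans (Tuple.sort (p ∘ (Fintype.equivFin ι).symm))).trans (Fintype.equivFin ι).symm

theorem sortDesc_eq_comp {ι : Type*} [Fintype ι] (p : ι → ℝ) :
    sortDesc p = p ∘ sortDescEquiv p := rfl

theorem sortDesc_antitone {ι : Type*} [Fintype ι] (p : ι → ℝ) : Antitone (sortDesc p) :=
  fun _ _ h => Tuple.monotone_sort (p ∘ (Fintype.equivFin ι).symm) (Fin.rev_le_rev.mpr h)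

variable {d k : ℕ}

/-- The overlap `∑ₓ √(r ⊗ p)ₓ √(t_{π x})` of `R ⊗ P` with the embedding of `T` permuted by `π`. -/
def permOverlap (r t : Fin d → ℝ) (p : Fin k → ℝ) (π : Equiv.Perm (Fin d × Fin k)) : ℝ :=
  ∑ x, √(prodDist r p x) * √(embedDist t k (π x))

variable {r t : Fin d → ℝ}

theorem prodDist_nonneg (hr : ∀ i, 0 ≤ r i) {p : Fin k → ℝ} (hp : ∀ s, 0 ≤ p s)
    (x : Fin d × Fin k) : 0 ≤ prodDist r p x := mul_nonneg (hr _) (hp _)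

theorem embedDist_nonneg (ht : ∀ i, 0 ≤ t i) (x : Fin d × Fin k) : 0 ≤ embedDist t k x := by
  unfold embedDist; split_ifs
  · exact ht _
  · exact le_rfl

theorem fidelity_sortDesc (hr : ∀ i, 0 ≤ r i) (ht : ∀ i, 0 ≤ t i) {p : Fin k → ℝ}
    (hp : ∀ s, 0 ≤ p s) :
    fidelity (diagOp (sortDesc (prodDist r p))) (diagOp (sortDesc (embedDist t k)))
      = permOverlap r t p ((sortDescEquiv (prodDist r p)).symm.trans
          (sortDescEquiv (embedDist t k))) ^ 2 := by
  rw [fidelity_diagOp (fun i => by rw [sortDesc_eq_comp]; exact prodDist_nonneg hr hp _)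
    (fun i => by rw [sortDesc_eq_comp]; exact embedDist_nonneg ht _)]
  congr 1
  unfold permOverlap
  rw [← Equiv.sum_comp (sortDescEquiv (prodDist r p))]
  simp [sortDesc_eq_comp]

/-- This is the rearrangement inequality: once both families are listed in decreasing order, they
vary together. -/
theorem permOverlap_le_sortDesc (p : Fin k → ℝ) (π : Equiv.Perm (Fin d × Fin k)) :
    permOverlap r t p π ≤ permOverlap r t p ((sortDescEquiv (prodDist r p)).symm.trans
      (sortDescEquiv (embedDist t k))) := by
  unfold permOverlap
  rw [← Equiv.sum_comp (sortDescEquiv (prodDist r p)),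
    ← Equiv.sum_comp (sortDescEquiv (prodDist r p)) (fun x => _ * √(embedDist t k (_)))]
  have hmono : Monovary (fun i => √(sortDesc (prodDist r p) i))
      (fun i => √(sortDesc (embedDist t k) i)) :=
    Antitone.monovary (fun _ _ h => Real.sqrt_le_sqrt (sortDesc_antitone _ h))
      (fun _ _ h => Real.sqrt_le_sqrt (sortDesc_antitone _ h))
  have := hmono.sum_mul_comp_perm_le_sum_mul
    (σ := ((sortDescEquiv (prodDist r p)).trans π).trans (sortDescEquiv (embedDist t k)).symm)
  simpa [sortDesc_eq_comp] using this

theorem exists_isGreatest_reorderedFidelities (hr : ∀ i, 0 ≤ r i) (ht : ∀ i, 0 ≤ t i)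
    (hk : 0 < k) : ∃ x, IsGreatest (reorderedFidelities r t k) x := by
  classical
  have : Nonempty (Fin k) := ⟨⟨0, hk⟩⟩
  -- The sorting permutation jumps with `p`, but the sorted overlap is a maximum of finitely many
  -- continuous functions, so compactness of the simplex applies.
  let G : (Fin k → ℝ) → ℝ := fun p =>
    Finset.univ.sup' Finset.univ_nonempty fun π => permOverlap r t p π
  have hG : Continuous G := by
    refine Continuous.finset_sup'_apply _ fun π _ => ?_
    unfold permOverlap prodDist
    fun_prop
  have hval : ∀ p ∈ stdSimplex ℝ (Fin k),
      fidelity (diagOp (sortDesc (prodDist r p))) (diagOp (sortDesc (embedDist t k))) = G p ^ 2 := by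
    intro p hp
    rw [fidelity_sortDesc hr ht hp.1]
    congr 1
    exact le_antisymm (Finset.le_sup' (fun π => permOverlap r t p π) (Finset.mem_univ _))
      (Finset.sup'_le _ _ fun π _ => permOverlap_le_sortDesc p π)
  obtain ⟨p, hp, hmax⟩ := (isCompact_stdSimplex ℝ (Fin k)).exists_isMaxOn
    ⟨_, single_mem_stdSimplex ℝ (⟨0, hk⟩ : Fin k)⟩ (hG.pow 2).continuousOn
  refine ⟨G p ^ 2, ⟨p, hp, (hval p hp).symm⟩, ?_⟩
  rintro _ ⟨q, hq, rfl⟩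
  rw [hval q hq]
  exact hmax hq

end Rearrangement

/-! ### Matchings and the size of the alphabet -/

section Matching

/-- A set of pairs in which no coordinate is repeated. -/
structure IsMatching {α β : Type*} (P : Finset (α × β)) : Prop where
  injOn_fst : Set.InjOn Prod.fst (P : Set (α × β))
  injOn_snd : Set.InjOn Prod.snd (P : Set (α × β))

theorem IsMatching.mono {α β : Type*} {P Q : Finset (α × β)} (hQ : IsMatching Q) (h : P ⊆ Q) :
    IsMatching P :=
  ⟨hQ.injOn_fst.mono (by exact_mod_cast h), hQ.injOn_snd.mono (by exact_mod_cast h)⟩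

/-- The ranges of `f` and `g` are in bijection inside a finite type, so their complements are too.
This completes a matching to a permutation. -/
theorem exists_perm_comp_eq {α β : Type*} [Finite β] {f g : α → β} (hf : f.Injective)
    (hg : g.Injective) : ∃ π : Equiv.Perm β, ∀ x, π (f x) = g x := by
  classical
  have := Fintype.ofFinite β
  let e : {y // y ∈ Set.range f} ≃ {y // y ∈ Set.range g} :=
    (Equiv.ofInjective f hf).symm.trans (Equiv.ofInjective g hg)
  refine ⟨e.extendSubtype, fun x => ?_⟩
  rw [Equiv.extendSubtype_apply_of_mem e (f x) ⟨x, rfl⟩]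
  have h : (⟨f x, ⟨x, rfl⟩⟩ : {y // y ∈ Set.range f}) = Equiv.ofInjective f hf x := rfl
  rw [h]
  simp [e]

/-- The weight of a matching between the entries of `R ⊗ P` and those of `T`. -/
def matchingOverlap {d : ℕ} {κ : Type*} (r t : Fin d → ℝ) (p : κ → ℝ)
    (P : Finset ((Fin d × κ) × Fin d)) : ℝ :=
  ∑ q ∈ P, √(prodDist r p q.1) * √(t q.2)

variable {d : ℕ} {r t : Fin d → ℝ}

theorem matchingOverlap_nonneg {κ : Type*} (r t : Fin d → ℝ) (p : κ → ℝ)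
    (P : Finset ((Fin d × κ) × Fin d)) : 0 ≤ matchingOverlap r t p P :=
  Finset.sum_nonneg fun _ _ => mul_nonneg (Real.sqrt_nonneg _) (Real.sqrt_nonneg _)

/-- Any distribution can be pushed forward along a map of letters, and no weight decreases. -/
theorem exists_stdSimplex_ge {κ μ : Type*} [Fintype κ] [Fintype μ] {p : κ → ℝ}
    (hp : p ∈ stdSimplex ℝ κ) (g : κ → μ) :
    ∃ p' ∈ stdSimplex ℝ μ, ∀ s, p s ≤ p' (g s) := by
  classical
  refine ⟨fun l => ∑ s with g s = l, p s, ⟨fun l => Finset.sum_nonneg fun s _ => hp.1 s, ?_⟩, ?_⟩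
  · exact (Finset.sum_fiberwise Finset.univ g p).trans hp.2
  · intro s
    exact Finset.single_le_sum (f := p) (fun s _ => hp.1 s) (by simp)

theorem exists_injOn_of_card_le {κ : Type*} {k : ℕ} (hk : 0 < k) (S : Finset κ) (h : S.card ≤ k) :
    ∃ g : κ → Fin k, Set.InjOn g (S : Set κ) := by
  classical
  obtain ⟨e⟩ : Nonempty (S ↪ Fin k) :=
    Function.Embedding.nonempty_of_card_le (by simpa using h)
  refine ⟨fun s => if h : s ∈ S then e ⟨s, h⟩ else ⟨0, hk⟩, fun x hx y hy hxy => ?_⟩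
  simp only [Finset.mem_coe] at hx hy
  simpa [hx, hy] using hxy

/-- Pairs with `tⱼ = 0` weigh nothing. The others number at most `schmidtRank t`, so the letters
they use inject into `k` letters. Pushing `p` forward decreases no weight, and the matching then
extends to a permutation. -/
theorem exists_reorderedFidelities_ge (hr : ∀ i, 0 ≤ r i) (ht : ∀ i, 0 ≤ t i) {κ : Type*}
    [Fintype κ] {p : κ → ℝ} (hp : p ∈ stdSimplex ℝ κ) {P : Finset ((Fin d × κ) × Fin d)}
    (hP : IsMatching P) {k : ℕ} (hk : 0 < k) (htk : schmidtRank t ≤ k) :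
    ∃ y ∈ reorderedFidelities r t k, matchingOverlap r t p P ^ 2 ≤ y := by
  classical
  let Q := P.filter fun q => t q.2 ≠ 0
  have hQ : IsMatching Q := hP.mono (Finset.filter_subset _ _)
  have hPQ : matchingOverlap r t p P = matchingOverlap r t p Q := by
    unfold matchingOverlap
    refine (Finset.sum_filter_of_ne fun q _ hq (h0 : t q.2 = 0) => hq ?_).symm
    simp [h0]
  have hcard : (Q.image fun q => q.1.2).card ≤ k := by
    refine Finset.card_image_le.trans (le_trans ?_ htk)
    unfold schmidtRank
    exact Finset.card_le_card_of_injOn Prod.snd (fun q hq => by simp_all [Q]) hQ.injOn_snd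
  obtain ⟨g, hg⟩ := exists_injOn_of_card_le hk _ hcard
  obtain ⟨p', hp', hpp'⟩ := exists_stdSimplex_ge hp g
  let f : Q → Fin d × Fin k := fun q => (q.1.1.1, g q.1.1.2)
  let f' : Q → Fin d × Fin k := fun q => (q.1.2, ⟨0, hk⟩)
  have hf : f.Injective := by
    intro x y hxy
    simp only [f, Prod.mk.injEq] at hxy
    have h2 : x.1.1.2 = y.1.1.2 := hg
      (Finset.mem_coe.mpr (Finset.mem_image_of_mem _ x.2))
      (Finset.mem_coe.mpr (Finset.mem_image_of_mem _ y.2)) hxy.2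
    exact Subtype.ext (hQ.injOn_fst x.2 y.2 (Prod.ext hxy.1 h2))
  have hf' : f'.Injective := by
    intro x y hxy
    simp only [f', Prod.mk.injEq] at hxy
    exact Subtype.ext (hQ.injOn_snd x.2 y.2 hxy.1)
  obtain ⟨π, hπ⟩ := exists_perm_comp_eq hf hf'
  refine ⟨_, ⟨p', hp', rfl⟩, ?_⟩
  rw [fidelity_sortDesc hr ht hp'.1, hPQ]
  refine pow_le_pow_left₀ (matchingOverlap_nonneg _ _ _ _)
    (le_trans ?_ (permOverlap_le_sortDesc p' π)) 2
  unfold matchingOverlap permOverlap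
  calc ∑ q ∈ Q, √(prodDist r p q.1) * √(t q.2)
      = ∑ q : Q, √(prodDist r p q.1.1) * √(t q.1.2) := (Finset.sum_coe_sort Q _).symm
    _ ≤ ∑ q : Q, √(prodDist r p' (f q)) * √(embedDist t k (π (f q))) := by
        refine Finset.sum_le_sum fun q _ => ?_
        rw [hπ]
        have h1 : embedDist t k (f' q) = t q.1.2 := by simp [embedDist, f']
        rw [h1]
        refine mul_le_mul_of_nonneg_right (Real.sqrt_le_sqrt ?_) (Real.sqrt_nonneg _)
        exact mul_le_mul_of_nonneg_left (hpp' _) (hr _)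
    _ = ∑ x ∈ Finset.univ.image f, √(prodDist r p' x) * √(embedDist t k (π x)) :=
        (Finset.sum_image
          (f := fun x => √(prodDist r p' x) * √(embedDist t k (π x))) hf.injOn).symm
    _ ≤ _ := Finset.sum_le_sum_of_subset_of_nonneg (Finset.subset_univ _)
        fun _ _ _ => mul_nonneg (Real.sqrt_nonneg _) (Real.sqrt_nonneg _)

/-- The matching that is contained in a permutation of the joint alphabet. -/
def permMatching {k : ℕ} (π : Equiv.Perm (Fin d × Fin k)) : Finset ((Fin d × Fin k) × Fin d) :=
  Finset.univ.filter fun q => (π q.1).1 = q.2 ∧ ((π q.1).2 : ℕ) = 0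

theorem permMatching_isMatching {k : ℕ} (π : Equiv.Perm (Fin d × Fin k)) :
    IsMatching (permMatching π) := by
  constructor
  · rintro ⟨x, j⟩ hx ⟨y, l⟩ hy h
    simp_all [permMatching]
  · rintro ⟨x, j⟩ hx ⟨y, l⟩ hy h
    simp only [permMatching, Finset.coe_filter, Finset.mem_univ, true_and, Set.mem_ofPred_eq]
      at hx hy h
    subst h
    have : π x = π y := Prod.ext (hx.1.trans hy.1.symm) (Fin.ext (hx.2.trans hy.2.symm))
    rw [π.injective this]

/-- The embedding of `T` vanishes off the first letter, so only positions that `π` sends to that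
letter contribute. -/
theorem permOverlap_eq_matchingOverlap {k : ℕ} (p : Fin k → ℝ) (π : Equiv.Perm (Fin d × Fin k)) :
    permOverlap r t p π = matchingOverlap r t p (permMatching π) := by
  unfold permOverlap matchingOverlap permMatching
  rw [Finset.sum_filter, Fintype.sum_prod_type (α₂ := Fin d)]
  apply Finset.sum_congr rfl
  intro x _
  simp only [ite_and]
  rw [Finset.sum_ite_eq]
  by_cases h : ((π x).2 : ℕ) = 0 <;> simp [embedDist, h]

theorem exists_matchingOverlap_of_mem {k : ℕ} (hr : ∀ i, 0 ≤ r i) (ht : ∀ i, 0 ≤ t i) {y : ℝ}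
    (hy : y ∈ reorderedFidelities r t k) :
    ∃ p ∈ stdSimplex ℝ (Fin k), ∃ P : Finset ((Fin d × Fin k) × Fin d), IsMatching P ∧
      y = matchingOverlap r t p P ^ 2 := by
  obtain ⟨p, hp, rfl⟩ := hy
  refine ⟨p, hp, permMatching ((sortDescEquiv (prodDist r p)).symm.trans
    (sortDescEquiv (embedDist t k))), permMatching_isMatching _, ?_⟩
  rw [fidelity_sortDesc hr ht hp.1, permOverlap_eq_matchingOverlap]

theorem schmidtRank_pos {d : ℕ} {t : Fin d → ℝ} (ht : t ≠ 0) : 0 < schmidtRank t := by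
  obtain ⟨i, hi⟩ := Function.ne_iff.mp ht
  exact Finset.card_pos.mpr ⟨i, by simpa using hi⟩

/-- The maximum over `schmidtRank t` letters dominates every matching on every alphabet, and each
larger alphabet reaches it again. -/
theorem exists_reordered_maximum (hr : ∀ i, 0 ≤ r i) (ht : ∀ i, 0 ≤ t i) (ht0 : t ≠ 0) :
    ∃ x, (∀ k, schmidtRank t ≤ k → IsGreatest (reorderedFidelities r t k) x) ∧
      ∀ (κ : Type) [Fintype κ] (p : κ → ℝ) (P : Finset ((Fin d × κ) × Fin d)),
        p ∈ stdSimplex ℝ κ → IsMatching P → matchingOverlap r t p P ^ 2 ≤ x := by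
  have hpos := schmidtRank_pos ht0
  obtain ⟨x, hx⟩ := exists_isGreatest_reorderedFidelities hr ht hpos
  have hub : ∀ (κ : Type) [Fintype κ] (p : κ → ℝ) (P : Finset ((Fin d × κ) × Fin d)),
        p ∈ stdSimplex ℝ κ → IsMatching P → matchingOverlap r t p P ^ 2 ≤ x := by
    intro κ _ p P hp hP
    obtain ⟨y, hy, hle⟩ := exists_reorderedFidelities_ge hr ht hp hP hpos le_rfl
    exact hle.trans (hx.2 hy)
  refine ⟨x, fun k hk => ?_, hub⟩
  have hub' : x ∈ upperBounds (reorderedFidelities r t k) := by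
    intro y hy
    obtain ⟨p, hp, P, hP, rfl⟩ := exists_matchingOverlap_of_mem hr ht hy
    exact hub _ p P hp hP
  obtain ⟨p, hp, P, hP, hxP⟩ := exists_matchingOverlap_of_mem hr ht hx.1
  obtain ⟨y, hy, hle⟩ := exists_reorderedFidelities_ge hr ht hp hP (hpos.trans_le hk) hk
  have : y = x := le_antisymm (hub' hy) (hxP ▸ hle)
  exact ⟨this ▸ hy, hub'⟩

end Matching

/-! ### Birkhoff's theorem and von Neumann's trace inequality -/

section TraceInequality

/-- A linear functional with nonnegative coefficients on doubly substochastic matrices is bounded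
by its value at some matching. -/
theorem exists_matching_sum_ge {X J : Type*} [Fintype X] [Fintype J] (D w : X → J → ℝ)
    (hD : ∀ x j, 0 ≤ D x j) (hrow : ∀ x, ∑ j, D x j ≤ 1) (hcol : ∀ j, ∑ x, D x j ≤ 1) :
    ∃ P : Finset (X × J), IsMatching P ∧ ∑ x, ∑ j, D x j * w x j ≤ ∑ q ∈ P, w q.1 q.2 := by
  classical
  -- Putting the row and column deficits on the diagonal completes `D` to a doubly stochastic
  -- matrix. By Birkhoff, a linear functional of it is at most its value at some permutation matrix.
  let M : Matrix (X ⊕ J) (X ⊕ J) ℝ := Matrix.fromBlocks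
    (Matrix.diagonal fun x => 1 - ∑ j, D x j) (Matrix.of D) (Matrix.of D).transpose
    (Matrix.diagonal fun j => 1 - ∑ x, D x j)
  have hM : M ∈ doublyStochastic ℝ (X ⊕ J) := by
    rw [mem_doublyStochastic_iff_sum]
    refine ⟨?_, ?_, ?_⟩
    · rintro (i | i) (j | j)
      · simp only [M, Matrix.fromBlocks_apply₁₁, Matrix.diagonal_apply]
        split_ifs
        · linarith [hrow i]
        · exact le_rfl
      · exact hD i j
      · exact hD j i
      · simp only [M, Matrix.fromBlocks_apply₂₂, Matrix.diagonal_apply]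
        split_ifs
        · linarith [hcol i]
        · exact le_rfl
    · rintro (i | i) <;> simp [M, Fintype.sum_sum_type, Matrix.diagonal_apply]
    · rintro (i | i) <;> simp [M, Fintype.sum_sum_type, Matrix.diagonal_apply]
  let L : Matrix (X ⊕ J) (X ⊕ J) ℝ →ₗ[ℝ] ℝ :=
    ∑ x, ∑ j, w x j • Matrix.entryLinearMap ℝ ℝ (Sum.inl x) (Sum.inr j)
  have hL : ∀ N, L N = ∑ x, ∑ j, N (Sum.inl x) (Sum.inr j) * w x j := by
    intro N
    simp [L, LinearMap.sum_apply, mul_comm]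
  rw [← SetLike.mem_coe, doublyStochastic_eq_convexHull_permMatrix] at hM
  obtain ⟨_, ⟨σ, rfl⟩, hσ⟩ := ConvexOn.exists_ge_of_mem_convexHull
    (L.convexOn convex_univ) (Set.subset_univ _) hM
  -- Only the points of `X` that `σ` sends into `J` are matched; the functional ignores the other
  -- blocks.
  refine ⟨Finset.univ.filter fun q => σ (Sum.inl q.1) = Sum.inr q.2, ⟨?_, ?_⟩, ?_⟩
  · rintro ⟨x, j⟩ hx ⟨y, l⟩ hy h
    simp_all
  · rintro ⟨x, j⟩ hx ⟨y, l⟩ hy h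
    simp only [Finset.coe_filter, Finset.mem_univ, true_and, Set.mem_ofPred_eq] at hx hy h
    subst h
    have := σ.injective (hx.trans hy.symm)
    simp_all
  · rw [hL, hL] at hσ
    refine hσ.trans (le_of_eq ?_)
    rw [Finset.sum_filter, Fintype.sum_prod_type]
    simp [Equiv.Perm.permMatrix, PEquiv.toMatrix_apply, eq_comm]

theorem _root_.Orthonormal.sum_norm_inner_sq_le_one {E ι : Type*} [NormedAddCommGroup E]
    [InnerProductSpace ℂ E] [Fintype ι] {f : ι → E} (hf : Orthonormal ℂ f) {y : E}
    (hy : ‖y‖ = 1) : ∑ i, ‖inner ℂ (f i) y‖ ^ 2 ≤ 1 := by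
  simpa [hy] using hf.sum_inner_products_le y (s := Finset.univ)

/-- A form of von Neumann's trace inequality. -/
theorem exists_matching_norm_sum_le {E F X J : Type*} [NormedAddCommGroup E]
    [InnerProductSpace ℂ E] [NormedAddCommGroup F] [InnerProductSpace ℂ F] [Fintype X] [Fintype J]
    {f : X → E} {g : J → E} {f' : X → F} {g' : J → F} (hf : Orthonormal ℂ f)
    (hg : Orthonormal ℂ g) (hf' : Orthonormal ℂ f') (hg' : Orthonormal ℂ g') (w : X → J → ℝ)
    (hw : ∀ x j, 0 ≤ w x j) :
    ∃ P : Finset (X × J), IsMatching P ∧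
      ‖∑ x, ∑ j, (w x j : ℂ) * (inner ℂ (f x) (g j) * inner ℂ (f' x) (g' j))‖
        ≤ ∑ q ∈ P, w q.1 q.2 := by
  -- By AM-GM this dominates the product of the two overlaps, and Bessel's inequality makes it
  -- doubly substochastic.
  let D : X → J → ℝ := fun x j =>
    (‖inner ℂ (f x) (g j)‖ ^ 2 + ‖inner ℂ (f' x) (g' j)‖ ^ 2) / 2
  obtain ⟨P, hP, hle⟩ := exists_matching_sum_ge D w (fun x j => by positivity)
    (fun x => by
      have h1 := hg.sum_norm_inner_sq_le_one (hf.1 x)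
      have h2 := hg'.sum_norm_inner_sq_le_one (hf'.1 x)
      simp only [norm_inner_symm _ (f x), norm_inner_symm _ (f' x)] at h1 h2
      simp only [D, ← Finset.sum_div, Finset.sum_add_distrib]
      linarith)
    (fun j => by
      have h1 := hf.sum_norm_inner_sq_le_one (hg.1 j)
      have h2 := hf'.sum_norm_inner_sq_le_one (hg'.1 j)
      simp only [D, ← Finset.sum_div, Finset.sum_add_distrib]
      linarith)
  refine ⟨P, hP, le_trans ?_ hle⟩
  refine (norm_sum_le _ _).trans (Finset.sum_le_sum fun x _ => ?_)
  refine (norm_sum_le _ _).trans (Finset.sum_le_sum fun j _ => ?_)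
  rw [norm_mul, norm_mul, Complex.norm_real, Real.norm_of_nonneg (hw x j), mul_comm]
  refine mul_le_mul_of_nonneg_right ?_ (hw x j)
  simp only [D]
  nlinarith [sq_nonneg (‖inner ℂ (f x) (g j)‖ - ‖inner ℂ (f' x) (g' j)‖)]

end TraceInequality

/-! ### Product vectors and the Schmidt decomposition -/

section TensorVectors

variable {a b e₁ e₂ : Type*} [Fintype a] [Fintype b] [Fintype e₁] [Fintype e₂]

theorem inner_tensorVec (u u' : EuclideanSpace ℂ a) (v v' : EuclideanSpace ℂ b) :
    inner ℂ (tensorVec u v) (tensorVec u' v') = inner ℂ u u' * inner ℂ v v' := by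
  simp only [PiLp.inner_apply, tensorVec, Fintype.sum_prod_type, Finset.sum_mul_sum]
  refine Finset.sum_congr rfl fun i _ => Finset.sum_congr rfl fun j _ => ?_
  simp only [RCLike.inner_apply, map_mul]
  ring

theorem orthonormal_tensorVec {ι κ : Type*} {f : ι → EuclideanSpace ℂ a}
    {g : κ → EuclideanSpace ℂ b} (hf : Orthonormal ℂ f) (hg : Orthonormal ℂ g) :
    Orthonormal ℂ fun x : ι × κ => tensorVec (f x.1) (g x.2) := by
  classical
  rw [orthonormal_iff_ite] at *
  rintro ⟨i, s⟩ ⟨j, l⟩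
  rw [inner_tensorVec, hf, hg]
  by_cases h : i = j <;> simp [h]

omit [Fintype a] [Fintype b] [Fintype e₁] [Fintype e₂] in
theorem withAncilla_tensorVec (u : EuclideanSpace ℂ a) (v : EuclideanSpace ℂ b)
    (g : EuclideanSpace ℂ e₁) (h : EuclideanSpace ℂ e₂) :
    withAncilla (tensorVec u v) (tensorVec g h) = tensorVec (tensorVec u g) (tensorVec v h) := by
  ext x
  simp only [withAncilla, tensorVec]
  ring

omit [Fintype a] [Fintype b] [Fintype e₁] [Fintype e₂] in
theorem withAncilla_sum_sum {ι κ : Type*} [Fintype ι] [Fintype κ] (c : ι → ℂ) (c' : κ → ℂ)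
    (f : ι → EuclideanSpace ℂ (a × b)) (g : κ → EuclideanSpace ℂ (e₁ × e₂)) :
    withAncilla (∑ i, c i • f i) (∑ s, c' s • g s)
      = ∑ x : ι × κ, (c x.1 * c' x.2) • withAncilla (f x.1) (g x.2) := by
  ext y
  simp only [withAncilla, WithLp.ofLp_sum, WithLp.ofLp_smul, Finset.sum_apply, Pi.smul_apply,
    smul_eq_mul, Finset.sum_mul_sum, Fintype.sum_prod_type]
  refine Finset.sum_congr rfl fun i _ => Finset.sum_congr rfl fun j _ => ?_
  ring

/-- The action of a matrix on vectors, as a linear map of Euclidean spaces. -/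
abbrev act {m n : Type*} [Fintype n] [DecidableEq n] (W : Matrix m n ℂ) :
    EuclideanSpace ℂ n →ₗ[ℂ] EuclideanSpace ℂ m :=
  Matrix.toEuclideanLin W

theorem act_apply {m n : Type*} [Fintype n] [DecidableEq n] (W : Matrix m n ℂ)
    (u : EuclideanSpace ℂ n) : act W u = WithLp.toLp 2 (W.mulVec u.ofLp) := rfl

theorem act_kronecker_tensorVec {m n : Type*} [DecidableEq a] [DecidableEq b]
    (W : Matrix m a ℂ) (V : Matrix n b ℂ) (u : EuclideanSpace ℂ a) (v : EuclideanSpace ℂ b) :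
    act (W ⊗ₖ V) (tensorVec u v) = tensorVec (act W u) (act V v) := by
  ext x
  simp only [act_apply, tensorVec, Matrix.mulVec, dotProduct, Fintype.sum_prod_type,
    Finset.sum_mul_sum, Matrix.kroneckerMap_apply]
  refine Finset.sum_congr rfl fun i _ => Finset.sum_congr rfl fun j _ => ?_
  ring

theorem inner_act_act {m : Type*} [Fintype m] [DecidableEq a] {W : Matrix m a ℂ}
    (hW : W.conjTranspose * W = 1) (u v : EuclideanSpace ℂ a) :
    inner ℂ (act W u) (act W v) = inner ℂ u v := by
  rw [EuclideanSpace.inner_eq_star_dotProduct, EuclideanSpace.inner_eq_star_dotProduct, act_apply,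
    act_apply, Matrix.star_mulVec, dotProduct_comm, ← Matrix.dotProduct_mulVec,
    Matrix.mulVec_mulVec, hW, Matrix.one_mulVec, dotProduct_comm]

theorem orthonormal_act {m ι : Type*} [Fintype m] [DecidableEq a] {W : Matrix m a ℂ}
    (hW : W.conjTranspose * W = 1) {f : ι → EuclideanSpace ℂ a} (hf : Orthonormal ℂ f) :
    Orthonormal ℂ fun i => act W (f i) := by
  classical
  rw [orthonormal_iff_ite] at *
  intro i j
  rw [inner_act_act hW, hf]

/-- This is the singular value decomposition of the coefficient matrix `C`: an orthonormal
eigenbasis `Bₛ` of `C†C` has orthogonal images `C Bₛ` with squared norms `pₛ`. -/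
theorem exists_schmidt_decomposition {m n : Type} [Fintype m] [Fintype n]
    (ζ : EuclideanSpace ℂ (m × n)) :
    ∃ (κ : Type) (_ : Fintype κ) (p : κ → ℝ) (g : κ → EuclideanSpace ℂ m)
      (h : κ → EuclideanSpace ℂ n), (∀ s, 0 ≤ p s) ∧ Orthonormal ℂ g ∧ Orthonormal ℂ h ∧
      ζ = ∑ s, (√(p s) : ℂ) • tensorVec (g s) (h s) := by
  classical
  let C : Matrix m n ℂ := Matrix.of fun i j => ζ (i, j)
  have hH : (C.conjTranspose * C).PosSemidef := Matrix.posSemidef_conjTranspose_mul_self C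
  let p := hH.isHermitian.eigenvalues
  let B := hH.isHermitian.eigenvectorBasis
  have hp : ∀ s, 0 ≤ p s := hH.eigenvalues_nonneg
  have hCB : ∀ s s', inner ℂ (act C (B s)) (act C (B s')) = if s = s' then (p s : ℂ) else 0 := by
    intro s s'
    have h1 : inner ℂ (act C (B s)) (act C (B s')) = inner ℂ (B s) ((p s' : ℂ) • B s') := by
      rw [EuclideanSpace.inner_eq_star_dotProduct, EuclideanSpace.inner_eq_star_dotProduct,
        act_apply, act_apply, Matrix.star_mulVec, dotProduct_comm, ← Matrix.dotProduct_mulVec,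
        Matrix.mulVec_mulVec, hH.isHermitian.mulVec_eigenvectorBasis, dotProduct_comm]
      rfl
    rw [h1, inner_smul_right, orthonormal_iff_ite.mp B.orthonormal]
    split_ifs with h
    · rw [h, mul_one]
    · rw [mul_zero]
  have hzero : ∀ s, p s = 0 → act C (B s) = 0 := by
    intro s hs
    have := hCB s s
    rw [if_pos rfl, hs, Complex.ofReal_zero, inner_self_eq_zero] at this
    exact this
  have hexp : ∀ i j, ζ (i, j) = ∑ s, act C (B s) i * star (B s j) := by
    intro i j
    -- Inserting the resolution of the identity gives `C = ∑ₛ (C Bₛ) Bₛ†`.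
    have hU : C * ((hH.isHermitian.eigenvectorUnitary : Matrix n n ℂ)
        * star (hH.isHermitian.eigenvectorUnitary : Matrix n n ℂ)) = C := by
      rw [Unitary.mul_star_self_of_mem hH.isHermitian.eigenvectorUnitary.2, Matrix.mul_one]
    replace hU := congrFun (congrFun hU i) j
    rw [← Matrix.mul_assoc, Matrix.mul_apply] at hU
    exact hU.symm
  have hpc : ∀ s : {s // p s ≠ 0}, (√(p s) : ℂ) ≠ 0 := fun s =>
    Complex.ofReal_ne_zero.mpr (Real.sqrt_ne_zero'.mpr ((hp s).lt_of_ne' s.2))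
  -- Zero eigenvalues are dropped so that `C Bₛ` can be normalised; their terms vanish by `hzero`.
  refine ⟨{s // p s ≠ 0}, inferInstance, fun s => p s, fun s => (√(p s) : ℂ)⁻¹ • act C (B s),
    fun s => WithLp.toLp 2 (star (B s).ofLp), fun s => hp s, ?_, ?_, ?_⟩
  · rw [orthonormal_iff_ite]
    rintro s s'
    rw [inner_smul_left, inner_smul_right, hCB]
    by_cases h : s = s'
    · subst h
      rw [if_pos rfl, if_pos rfl, map_inv₀, Complex.conj_ofReal]
      have h2 : (p s : ℂ) = (√(p s) : ℂ) * (√(p s) : ℂ) := by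
        rw [← Complex.ofReal_mul, Real.mul_self_sqrt (hp s)]
      have := hpc s
      rw [h2]
      field_simp
    · rw [if_neg h, if_neg (fun h' => h (Subtype.ext h')), mul_zero, mul_zero]
  · rw [orthonormal_iff_ite]
    rintro s s'
    have h1 : inner ℂ (WithLp.toLp 2 (star (B s).ofLp) : EuclideanSpace ℂ n)
        (WithLp.toLp 2 (star (B s').ofLp)) = inner ℂ (B s') (B s) := by
      simp [PiLp.inner_apply, mul_comm]
    rw [h1, orthonormal_iff_ite.mp B.orthonormal]
    simp [Subtype.ext_iff, eq_comm]
  · ext ⟨i, j⟩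
    rw [hexp]
    simp only [WithLp.ofLp_sum, WithLp.ofLp_smul, Finset.sum_apply, Pi.smul_apply, tensorVec,
      smul_eq_mul]
    rw [← Finset.sum_filter_of_ne (p := fun s => p s ≠ 0) fun s _ hs (h0 : p s = 0) => hs (by
      rw [hzero s h0]; simp),
      Finset.sum_subtype (p := fun s => p s ≠ 0) _ (fun s => by simp)]
    refine Finset.sum_congr rfl fun s _ => ?_
    have := hpc s
    rw [← mul_assoc, mul_inv_cancel_left₀ this]
    rfl

end TensorVectors

/-! ### Amplitudes and the matching bound on overlaps -/

section Overlap

variable {a b : Type*} [Fintype a] [DecidableEq a] [Fintype b] [DecidableEq b]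

/-- The Kraus operators of an isometry `W : A → A ⊗ M`. -/
def krausOp {a m : Type*} (W : Matrix (a × m) a ℂ) (s : m) : Matrix a a ℂ :=
  Matrix.of fun i j => W (i, s) j

/-- The amplitudes `⟨ψ|(Kₛ ⊗ Lₙ)|φ⟩`. -/
def amplitude {m n : Type*} [Fintype m] [Fintype n] (ψ φ : EuclideanSpace ℂ (a × b))
    (W : Matrix (a × m) a ℂ) (V : Matrix (b × n) b ℂ) : EuclideanSpace ℂ (m × n) :=
  WithLp.toLp 2 fun y => inner ℂ ψ (act (krausOp W y.1 ⊗ₖ krausOp V y.2) φ)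

/-- Regrouping the indices separates system from environment. Pairing with `ζ` thus becomes a linear
functional on the amplitude vector. -/
theorem inner_withAncilla_act {m n : Type*} [Fintype m] [Fintype n]
    (ψ φ : EuclideanSpace ℂ (a × b)) (W : Matrix (a × m) a ℂ) (V : Matrix (b × n) b ℂ)
    (ζ : EuclideanSpace ℂ (m × n)) :
    inner ℂ (withAncilla ψ ζ) (act (W ⊗ₖ V) φ) = inner ℂ ζ (amplitude ψ φ W V) := by
  simp only [PiLp.inner_apply, amplitude, RCLike.inner_apply]
  rw [← Equiv.sum_comp (Equiv.prodProdProdComm a b m n), Fintype.sum_prod_type, Finset.sum_comm]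
  refine Finset.sum_congr rfl fun y _ => ?_
  rw [Finset.sum_mul]
  refine Finset.sum_congr rfl fun x _ => ?_
  simp only [withAncilla, Equiv.prodProdProdComm_apply, map_mul]
  rw [mul_comm (starRingEnd ℂ (ψ.ofLp (x.1, x.2))), ← mul_assoc, mul_right_comm]
  rfl

variable {ψ φ : EuclideanSpace ℂ (a × b)}
  {r t : Fin (min (Fintype.card a) (Fintype.card b)) → ℝ}

omit [DecidableEq a] [DecidableEq b] in
theorem IsSchmidt.ne_zero (hr : IsSchmidt ψ r) (hψ : ψ ≠ 0) : r ≠ 0 := by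
  rintro rfl
  obtain ⟨u, v, -, -, h⟩ := hr.decomposition
  exact hψ (by simpa using h)

theorem norm_sq_schmidt {ι m n : Type*} [Fintype ι] [Fintype m] [Fintype n] {p : ι → ℝ}
    (hp : ∀ i, 0 ≤ p i) {f : ι → EuclideanSpace ℂ m} {g : ι → EuclideanSpace ℂ n}
    (hf : Orthonormal ℂ f) (hg : Orthonormal ℂ g) :
    ‖∑ i, (√(p i) : ℂ) • tensorVec (f i) (g i)‖ ^ 2 = ∑ i, p i := by
  classical
  have hfg : Orthonormal ℂ fun i => tensorVec (f i) (g i) :=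
    (orthonormal_tensorVec hf hg).comp (fun i => (i, i)) fun i j h => (Prod.mk.inj h).1
  rw [← Complex.ofReal_inj]
  have := hfg.inner_sum (fun i => (√(p i) : ℂ)) (fun i => (√(p i) : ℂ)) Finset.univ
  rw [inner_self_eq_norm_sq_to_K] at this
  push_cast
  refine this.trans (Finset.sum_congr rfl fun i _ => ?_)
  rw [Complex.conj_ofReal, ← Complex.ofReal_mul, Real.mul_self_sqrt (hp i)]

/-- The overlap of `ψ ⊗ ζ` with an isometrically embedded `φ` is bounded by some matching. -/
theorem exists_matchingOverlap_ge (hr : IsSchmidt ψ r) (ht : IsSchmidt φ t) {m n : Type}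
    [Fintype m] [Fintype n] {W : Matrix (a × m) a ℂ} {V : Matrix (b × n) b ℂ}
    (hW : W.conjTranspose * W = 1) (hV : V.conjTranspose * V = 1)
    {ζ : EuclideanSpace ℂ (m × n)} (hζ : ‖ζ‖ = 1) :
    ∃ (κ : Type) (_ : Fintype κ) (p : κ → ℝ) (P : Finset ((Fin _ × κ) × Fin _)),
      p ∈ stdSimplex ℝ κ ∧ IsMatching P ∧
      ‖inner ℂ (withAncilla ψ ζ) (act (W ⊗ₖ V) φ)‖ ≤ matchingOverlap r t p P := by
  obtain ⟨u, v, hu, hv, hψ⟩ := hr.decomposition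
  obtain ⟨u', v', hu', hv', hφ⟩ := ht.decomposition
  obtain ⟨κ, _, p, g, h, hp, hg, hh, hζ'⟩ := exists_schmidt_decomposition ζ
  have hp1 : ∑ s, p s = 1 := by
    rw [← norm_sq_schmidt hp hg hh, ← hζ', hζ, one_pow]
  obtain ⟨P, hP, hle⟩ := exists_matching_norm_sum_le (orthonormal_tensorVec hu hg)
    (orthonormal_act hW hu') (orthonormal_tensorVec hv hh) (orthonormal_act hV hv')
    (fun x j => √(prodDist r p x) * √(t j)) (fun x j => by positivity)
  refine ⟨κ, inferInstance, p, P, ⟨hp, hp1⟩, hP, le_trans (le_of_eq ?_) hle⟩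
  congr 1
  conv_lhs => rw [hψ, hζ', withAncilla_sum_sum, hφ, map_sum, sum_inner]
  refine Finset.sum_congr rfl fun x _ => ?_
  rw [inner_sum]
  refine Finset.sum_congr rfl fun j _ => ?_
  rw [map_smul, act_kronecker_tensorVec, withAncilla_tensorVec, inner_smul_left, inner_smul_right,
    inner_tensorVec, ← Complex.ofReal_mul, Complex.conj_ofReal, ← mul_assoc, ← Complex.ofReal_mul,
    prodDist, Real.sqrt_mul (hr.nonneg _)]

/-- Orthonormal families of the same size are related by a unitary matrix. -/
theorem exists_unitary_act_eq {ι : Type*} [Fintype ι] [DecidableEq ι] {n : ℕ}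
    {f g : Fin n → EuclideanSpace ℂ ι} (hf : Orthonormal ℂ f) (hg : Orthonormal ℂ g) :
    ∃ U ∈ Matrix.unitaryGroup ι ℂ, ∀ j, act U (f j) = g j := by
  have hcard : n ≤ Fintype.card ι := by
    have := hf.linearIndependent.fintype_card_le_finrank
    simpa using this
  obtain ⟨e⟩ : Nonempty (Fin n ↪ ι) := Function.Embedding.nonempty_of_card_le (by simpa using hcard)
  -- Both families extend to orthonormal bases along the same embedding `e`, so the change of basis
  -- carries one to the other.
  have key : ∀ f : Fin n → EuclideanSpace ℂ ι, Orthonormal ℂ f →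
      ∃ B : OrthonormalBasis ι ℂ (EuclideanSpace ℂ ι), ∀ j, B (e j) = f j := by
    intro f hf
    have hfin : Module.finrank ℂ (EuclideanSpace ℂ ι) = Fintype.card ι := finrank_euclideanSpace
    have hon : Orthonormal ℂ ((Set.range e).domRestrict (Function.extend e f 0)) := by
      have : (Set.range e).domRestrict (Function.extend e f 0)
          = f ∘ (Equiv.ofInjective e e.injective).symm := by
        ext1 ⟨_, j, rfl⟩
        have h1 : (⟨e j, ⟨j, rfl⟩⟩ : Set.range e) = Equiv.ofInjective e e.injective j := rfl
        rw [Function.comp_apply, h1, Equiv.symm_apply_apply]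
        exact e.injective.extend_apply f 0 j
      rw [this]
      exact hf.comp _ (Equiv.injective _)
    obtain ⟨B, hB⟩ := Orthonormal.exists_orthonormalBasis_extension_of_card_eq hfin hon
    exact ⟨B, fun j => (hB _ ⟨j, rfl⟩).trans (e.injective.extend_apply f 0 j)⟩
  obtain ⟨B, hB⟩ := key f hf
  obtain ⟨C, hC⟩ := key g hg
  let T : EuclideanSpace ℂ ι ≃ₗᵢ[ℂ] EuclideanSpace ℂ ι := B.equiv C (Equiv.refl ι)
  let U : Matrix ι ι ℂ := Matrix.toEuclideanLin.symm T.toLinearEquiv.toLinearMap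
  have hU : ∀ x, act U x = T x := fun x => by
    simp only [act, U, LinearEquiv.apply_symm_apply]; rfl
  refine ⟨U, ?_, fun j => ?_⟩
  · rw [Matrix.mem_unitaryGroup_iff']
    ext i j
    have h1 := T.inner_map_map (EuclideanSpace.single i 1) (EuclideanSpace.single j 1)
    rw [← hU, ← hU] at h1
    simp only [act_apply, PiLp.ofLp_single, Matrix.mulVec_single_one] at h1
    simp [PiLp.inner_apply] at h1
    rw [Matrix.star_eq_conjTranspose, Matrix.mul_apply, Matrix.one_apply]
    simpa [mul_comm, eq_comm] using h1
  · rw [hU, ← hB, ← hC]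
    simp [T]

end Overlap

/-! ### Kraus and Stinespring forms of channels -/

section Channels

variable {a b a' b' m n : Type*} [Fintype a] [DecidableEq a] [Fintype b] [DecidableEq b]
  [Fintype a'] [Fintype b'] [Fintype m] [Fintype n]

/-- The completely positive map with given Kraus operators. -/
def krausMap (K : m → Matrix a' a ℂ) : Matrix a a ℂ →ₗ[ℂ] Matrix a' a' ℂ where
  toFun X := ∑ s, K s * X * (K s).conjTranspose
  map_add' X Y := by simp [Matrix.mul_add, Matrix.add_mul, Finset.sum_add_distrib]
  map_smul' c X := by simp [Finset.smul_sum]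

omit [DecidableEq a] [Fintype a'] in
theorem krausMap_apply (K : m → Matrix a' a ℂ) (X : Matrix a a ℂ) :
    krausMap K X = ∑ s, K s * X * (K s).conjTranspose := rfl

omit [Fintype a'] [Fintype b'] in
-- Both sides are linear in `X`, and on matrix units the Kronecker product factorises.
theorem tensorMap_krausMap (K : m → Matrix a' a ℂ) (L : n → Matrix b' b ℂ)
    (X : Matrix (a × b) (a × b) ℂ) :
    tensorMap (krausMap K) (krausMap L) X
      = ∑ y : m × n, (K y.1 ⊗ₖ L y.2) * X * (K y.1 ⊗ₖ L y.2).conjTranspose := by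
  have hterm : ∀ i i' j j', krausMap K (Matrix.single i i' 1) ⊗ₖ krausMap L (Matrix.single j j' 1)
      = ∑ y : m × n, (K y.1 ⊗ₖ L y.2) * Matrix.single (i, j) (i', j') (1 : ℂ)
          * (K y.1 ⊗ₖ L y.2).conjTranspose := by
    intro i i' j j'
    have h1 : (Matrix.single (i, j) (i', j') 1 : Matrix (a × b) (a × b) ℂ)
        = Matrix.single i i' 1 ⊗ₖ Matrix.single j j' 1 := by
      rw [Matrix.single_kronecker_single, mul_one]
    simp only [h1, Matrix.conjTranspose_kronecker, ← Matrix.mul_kronecker_mul]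
    ext x x'
    simp only [krausMap_apply, Matrix.kroneckerMap_apply, Matrix.sum_apply, Finset.sum_mul_sum,
      Fintype.sum_prod_type]
  have hX : X = ∑ i, ∑ i', ∑ j, ∑ j', X (i, j) (i', j') • Matrix.single (i, j) (i', j') (1 : ℂ) := by
    conv_lhs => rw [Matrix.matrix_eq_sum_single X, Fintype.sum_prod_type]
    refine Finset.sum_congr rfl fun i _ => ?_
    rw [Finset.sum_comm' (t' := Finset.univ) (s' := fun _ => Finset.univ) (by simp)]
    simp only [Fintype.sum_prod_type]
    refine Finset.sum_congr rfl fun i' _ => ?_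
    rw [Finset.sum_comm]
    simp [Matrix.smul_single]
  conv_rhs => rw [hX]
  unfold tensorMap
  simp only [hterm, Matrix.mul_sum, Matrix.sum_mul, Finset.smul_sum, Matrix.mul_smul,
    Matrix.smul_mul]
  rw [Finset.sum_comm]
  simp only [Finset.sum_comm (s := (Finset.univ : Finset (m × n)))]
  rw [Finset.sum_comm]

omit [Fintype a'] in
theorem mul_pureOp_mul_conjTranspose (K : Matrix a' a ℂ) (φ : EuclideanSpace ℂ a) :
    K * pureOp φ * K.conjTranspose = pureOp (act K φ) := by
  rw [pureOp_eq_vecMulVec, pureOp_eq_vecMulVec, Matrix.mul_vecMulVec, Matrix.vecMulVec_mul,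
    act_apply, Matrix.star_mulVec]

theorem id_eq_krausMap :
    (LinearMap.id : Matrix a a ℂ →ₗ[ℂ] Matrix a a ℂ) = krausMap fun _ : Unit => 1 := by
  ext1 X
  simp [krausMap_apply]

omit [DecidableEq a] in
theorem sum_krausOp_conjTranspose_mul (W : Matrix (a × m) a ℂ) :
    ∑ s, (krausOp W s).conjTranspose * krausOp W s = W.conjTranspose * W := by
  ext i j
  simp only [Matrix.sum_apply, Matrix.mul_apply, Matrix.conjTranspose_apply, krausOp,
    Matrix.of_apply, Fintype.sum_prod_type]
  rw [Finset.sum_comm]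

omit [DecidableEq a] in
theorem trace_krausMap_krausOp (W : Matrix (a × m) a ℂ) (X : Matrix a a ℂ) :
    (krausMap (krausOp W) X).trace = (W.conjTranspose * W * X).trace := by
  rw [krausMap_apply, Matrix.trace_sum]
  simp only [fun s => Matrix.trace_mul_cycle (krausOp W s) X (krausOp W s).conjTranspose]
  rw [← Matrix.trace_sum, ← Matrix.sum_mul, sum_krausOp_conjTranspose_mul W]

theorem isChannel_krausMap_krausOp {W : Matrix (a × m) a ℂ} (hW : W.conjTranspose * W = 1) :
    IsChannel (krausMap (krausOp W)) where
  completely_positive k X hX := by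
    rw [id_eq_krausMap, tensorMap_krausMap]
    exact Matrix.posSemidef_sum _ fun s _ => hX.mul_mul_conjTranspose_same _
  trace_preserving X := by
    rw [trace_krausMap_krausOp, hW, Matrix.one_mul]

/-- Choi's theorem, in Stinespring form. -/
theorem IsChannel.exists_isometry {E : Matrix a a ℂ →ₗ[ℂ] Matrix a a ℂ} (hE : IsChannel E) :
    ∃ (k : ℕ) (W : Matrix (a × Fin k) a ℂ), W.conjTranspose * W = 1 ∧
      E = krausMap (krausOp W) := by
  let e := Fintype.equivFin a
  -- The unnormalised maximally entangled vector: applying `E` to its first half produces the Choi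
  -- matrix `C`.
  let ω : a × Fin (Fintype.card a) → ℂ := fun x => if e x.1 = x.2 then 1 else 0
  have hpos := hE.completely_positive _ _ (Matrix.posSemidef_vecMulVec_self_star ω)
  set C := tensorMap E LinearMap.id (Matrix.vecMulVec ω (star ω)) with hC
  have hCE : ∀ α β i j, C (α, e i) (β, e j) = E (Matrix.single i j 1) α β := by
    intro α β i j
    simp [hC, tensorMap, Matrix.sum_apply, Matrix.vecMulVec_apply, ω, Matrix.single_apply,
      ite_and, apply_ite]
  let f := Fintype.equivFin (a × Fin (Fintype.card a))
  let Q := psdSqrt C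
  have hQ : ∀ x y, C x y = ∑ z, Q x z * star (Q y z) := by
    intro x y
    rw [← psdSqrt_mul_self hpos, Matrix.mul_apply]
    refine Finset.sum_congr rfl fun z _ => ?_
    rw [← (psdSqrt_isHermitian C).apply z y]
  -- The columns of the Hermitian root `Q`, for which `C = QQ†`, are reshaped into Kraus operators.
  let W : Matrix (a × Fin (Fintype.card (a × Fin (Fintype.card a)))) a ℂ :=
    Matrix.of fun x i => Q (x.1, e i) (f.symm x.2)
  have hsingle : ∀ i j, E (Matrix.single i j 1) = krausMap (krausOp W) (Matrix.single i j 1) := by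
    intro i j
    ext α β
    rw [← hCE, hQ, krausMap_apply, Matrix.sum_apply, ← Equiv.sum_comp f.symm]
    refine Finset.sum_congr rfl fun z _ => ?_
    simp [Matrix.mul_apply, Matrix.single_apply, krausOp, W, ite_and]
  have hEW : E = krausMap (krausOp W) := by
    refine Matrix.ext_linearMap _ fun i j => ?_
    ext1
    simpa using hsingle i j
  refine ⟨_, W, ?_, hEW⟩
  ext i j
  -- Testing trace preservation on this matrix unit reads off the `(i, j)` entry of `W†W`.
  have htr := hE.trace_preserving (Matrix.single j i 1)
  rw [hEW, trace_krausMap_krausOp, Matrix.trace_mul_single] at htr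
  simpa [Matrix.trace, Matrix.single_apply, Matrix.one_apply, ite_and, eq_comm] using htr

/-- The output fidelity of local channels in terms of amplitudes. -/
theorem fidelity_tensorMap_krausMap (ψ φ : EuclideanSpace ℂ (a × b)) (W : Matrix (a × m) a ℂ)
    (V : Matrix (b × n) b ℂ) :
    fidelity (pureOp ψ) (tensorMap (krausMap (krausOp W)) (krausMap (krausOp V)) (pureOp φ))
      = ‖amplitude ψ φ W V‖ ^ 2 := by
  have hsum : tensorMap (krausMap (krausOp W)) (krausMap (krausOp V)) (pureOp φ)
      = ∑ y : m × n, pureOp (act (krausOp W y.1 ⊗ₖ krausOp V y.2) φ) := by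
    rw [tensorMap_krausMap]
    simp only [mul_pureOp_mul_conjTranspose]
  rw [hsum, fidelity_pureOp (Matrix.posSemidef_sum _ fun y _ => pureOp_posSemidef _),
    EuclideanSpace.norm_sq_eq]
  have : ∀ (f : m × n → Matrix (a × b) (a × b) ℂ), expVal ψ (∑ y, f y) = ∑ y, expVal ψ (f y) := by
    intro f
    simp [expVal, Matrix.sum_mulVec, dotProduct_sum]
  rw [this]
  simp only [expVal_pureOp, amplitude]

theorem IsChannel.tensorMap_posSemidef {E : Matrix a a ℂ →ₗ[ℂ] Matrix a a ℂ}
    {F : Matrix b b ℂ →ₗ[ℂ] Matrix b b ℂ} (hE : IsChannel E) (hF : IsChannel F)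
    {X : Matrix (a × b) (a × b) ℂ} (hX : X.PosSemidef) : (tensorMap E F X).PosSemidef := by
  obtain ⟨k, W, -, rfl⟩ := hE.exists_isometry
  obtain ⟨l, V, -, rfl⟩ := hF.exists_isometry
  rw [tensorMap_krausMap]
  exact Matrix.posSemidef_sum _ fun s _ => hX.mul_mul_conjTranspose_same _

theorem IsChannel.trace_tensorMap {E : Matrix a a ℂ →ₗ[ℂ] Matrix a a ℂ}
    {F : Matrix b b ℂ →ₗ[ℂ] Matrix b b ℂ} (hE : IsChannel E) (hF : IsChannel F)
    (X : Matrix (a × b) (a × b) ℂ) : (tensorMap E F X).trace = X.trace := by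
  simp only [tensorMap, Matrix.trace_sum, Matrix.trace_smul, Matrix.trace_kronecker,
    hE.trace_preserving, hF.trace_preserving]
  simp [Matrix.trace, Matrix.single_apply, Fintype.sum_prod_type, ite_and]

end Channels

/-! ### Channels versus local unitaries with an ancilla -/

section LocalUnitary

variable {a b : Type*} [Fintype a] [DecidableEq a] [Fintype b] [DecidableEq b]
  {ψ φ : EuclideanSpace ℂ (a × b)} {r t : Fin (min (Fintype.card a) (Fintype.card b)) → ℝ}

/-- The ancilla `ζ = c / ‖c‖` turns the norm of the amplitude vector into an overlap, to which the
matching bound applies. -/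
theorem norm_sq_amplitude_le (hr : IsSchmidt ψ r) (ht : IsSchmidt φ t) {x : ℝ} (hx : 0 ≤ x)
    (hub : ∀ (κ : Type) [Fintype κ] (p : κ → ℝ) (P : Finset ((Fin _ × κ) × Fin _)),
      p ∈ stdSimplex ℝ κ → IsMatching P → matchingOverlap r t p P ^ 2 ≤ x)
    {m n : Type} [Fintype m] [Fintype n] {W : Matrix (a × m) a ℂ} {V : Matrix (b × n) b ℂ}
    (hW : W.conjTranspose * W = 1) (hV : V.conjTranspose * V = 1) :
    ‖amplitude ψ φ W V‖ ^ 2 ≤ x := by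
  set c := amplitude ψ φ W V with hc
  by_cases h0 : c = 0
  · simpa [h0] using hx
  have hn : ‖c‖ ≠ 0 := norm_ne_zero_iff.mpr h0
  have hζ : ‖((‖c‖⁻¹ : ℝ) : ℂ) • c‖ = 1 := by
    rw [norm_smul, Complex.norm_real, norm_inv, norm_norm, inv_mul_cancel₀ hn]
  obtain ⟨κ, _, p, P, hp, hP, hle⟩ := exists_matchingOverlap_ge hr ht hW hV hζ
  rw [inner_withAncilla_act, ← hc, inner_smul_left, Complex.conj_ofReal, norm_mul,
    inner_self_eq_norm_sq_to_K, norm_pow, RCLike.norm_ofReal, Complex.norm_real, norm_inv,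
    norm_norm, abs_norm, pow_two, inv_mul_cancel_left₀ hn] at hle
  exact (pow_le_pow_left₀ (norm_nonneg _) hle 2).trans (hub κ p P hp hP)

/-- The isometry `U (· ⊗ |0⟩)`. -/
def dilationIsometry {a : Type*} {k : ℕ} (U : Matrix (a × Fin (k + 1)) (a × Fin (k + 1)) ℂ) :
    Matrix (a × Fin (k + 1)) a ℂ :=
  U.submatrix id fun i => (i, 0)

theorem dilationIsometry_conjTranspose_mul {k : ℕ}
    {U : Matrix (a × Fin (k + 1)) (a × Fin (k + 1)) ℂ}
    (hU : U ∈ Matrix.unitaryGroup (a × Fin (k + 1)) ℂ) :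
    (dilationIsometry U).conjTranspose * dilationIsometry U = 1 := by
  rw [Matrix.mem_unitaryGroup_iff'] at hU
  have h : (dilationIsometry U).conjTranspose * dilationIsometry U
      = (star U * U).submatrix (fun i => (i, 0)) fun i => (i, 0) := by
    ext i j
    simp [dilationIsometry, Matrix.mul_apply, Matrix.star_apply]
  rw [h, hU]
  exact Matrix.submatrix_one _ fun i j hij => (Prod.mk.inj hij).1

theorem act_kronecker_withAncilla_single {k l : ℕ} (φ : EuclideanSpace ℂ (a × b))
    (U : Matrix (a × Fin (k + 1)) (a × Fin (k + 1)) ℂ)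
    (V : Matrix (b × Fin (l + 1)) (b × Fin (l + 1)) ℂ) :
    act (U ⊗ₖ V) (withAncilla φ (EuclideanSpace.single ((0 : Fin (k + 1)), (0 : Fin (l + 1))) 1))
      = act (dilationIsometry U ⊗ₖ dilationIsometry V) φ := by
  ext x
  simp only [act_apply, Matrix.mulVec, dotProduct, Matrix.kroneckerMap_apply, withAncilla,
    dilationIsometry, Matrix.submatrix_apply, id]
  rw [← Equiv.sum_comp (Equiv.prodProdProdComm a b (Fin (k + 1)) (Fin (l + 1))),
    Fintype.sum_prod_type]
  refine Finset.sum_congr rfl fun y _ => ?_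
  rw [Finset.sum_eq_single (0, 0)]
  · simp
  · rintro ⟨i, j⟩ _ hij
    simp_all
  · simp

/-- Discarding the ancillas after `U` and `V` gives local channels with fidelity `‖c‖²`, and `|⟨ζ,
c⟩| ≤ ‖c‖` by Cauchy–Schwarz. -/
theorem exists_fidelitiesLO_ge {x : ℝ} (hx : x ∈ fidelitiesLUAncilla ψ φ) :
    ∃ y ∈ fidelitiesLO (pureOp ψ) (pureOp φ), x ≤ y := by
  obtain ⟨k, l, ζ, U, V, hζ, hU, hV, rfl⟩ := hx
  have hW := dilationIsometry_conjTranspose_mul hU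
  have hW' := dilationIsometry_conjTranspose_mul hV
  refine ⟨_, ⟨_, _, isChannel_krausMap_krausOp hW, isChannel_krausMap_krausOp hW', rfl⟩, ?_⟩
  rw [fidelity_tensorMap_krausMap, fidelity_pureOp_pureOp, ← act_apply,
    act_kronecker_withAncilla_single, inner_withAncilla_act]
  refine pow_le_pow_left₀ (norm_nonneg _) ?_ 2
  simpa [hζ] using norm_inner_le_norm (𝕜 := ℂ) ζ
    (amplitude ψ φ (dilationIsometry U) (dilationIsometry V))

theorem permOverlap_sq_mem_fidelitiesLUAncilla (hr : IsSchmidt ψ r) (ht : IsSchmidt φ t) {k : ℕ}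
    {p : Fin (k + 1) → ℝ} (hp : p ∈ stdSimplex ℝ (Fin (k + 1)))
    (π : Equiv.Perm (Fin (min (Fintype.card a) (Fintype.card b)) × Fin (k + 1))) :
    permOverlap r t p π ^ 2 ∈ fidelitiesLUAncilla ψ φ := by
  obtain ⟨u, v, hu, hv, hψ⟩ := hr.decomposition
  obtain ⟨u', v', hu', hv', hφ⟩ := ht.decomposition
  let e : Fin (k + 1) → EuclideanSpace ℂ (Fin (k + 1)) := fun s => EuclideanSpace.single s 1
  have he : Orthonormal ℂ e := EuclideanSpace.orthonormal_single
  let ζ := ∑ s, (√(p s) : ℂ) • tensorVec (e s) (e s)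
  have hζ : ‖ζ‖ = 1 := by
    have h1 : ‖ζ‖ ^ 2 = 1 := (norm_sq_schmidt hp.1 he he).trans hp.2
    exact (pow_eq_one_iff_of_nonneg (norm_nonneg _) two_ne_zero).mp h1
  -- `y j` is the position in `R ⊗ P` that `π` pairs with `tⱼ`; `U` and `V` send the `j`-th Schmidt
  -- vectors of the seed there.
  let y : Fin (min (Fintype.card a) (Fintype.card b)) →
    Fin (min (Fintype.card a) (Fintype.card b)) × Fin (k + 1) := fun j => π.symm (j, 0)
  have hy : y.Injective := fun i j h => (Prod.mk.inj (π.symm.injective h)).1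
  have hue := orthonormal_tensorVec hu he
  have hve := orthonormal_tensorVec hv he
  obtain ⟨U, hU, hUe⟩ := exists_unitary_act_eq
    ((orthonormal_tensorVec hu' he).comp (fun j => (j, (0 : Fin (k + 1))))
      fun i j h => (Prod.mk.inj h).1) (hue.comp y hy)
  obtain ⟨V, hV, hVe⟩ := exists_unitary_act_eq
    ((orthonormal_tensorVec hv' he).comp (fun j => (j, (0 : Fin (k + 1))))
      fun i j h => (Prod.mk.inj h).1) (hve.comp y hy)
  refine ⟨k, k, ζ, U, V, hζ, hU, hV, ?_⟩
  have hφe : withAncilla φ (EuclideanSpace.single ((0 : Fin (k + 1)), (0 : Fin (k + 1))) 1)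
      = ∑ j, (√(t j) : ℂ) • tensorVec (tensorVec (u' j) (e 0)) (tensorVec (v' j) (e 0)) := by
    have h0 : EuclideanSpace.single ((0 : Fin (k + 1)), (0 : Fin (k + 1))) (1 : ℂ)
        = ∑ _ : Unit, (1 : ℂ) • tensorVec (e 0) (e 0) := by
      ext ⟨i, j⟩
      by_cases hi : i = 0 <;> by_cases hj : j = 0 <;>
        simp [tensorVec, e, hi, hj]
    rw [h0]
    conv_lhs => rw [hφ]
    rw [withAncilla_sum_sum, Fintype.sum_prod_type]
    simp [withAncilla_tensorVec]
  have hψζ : withAncilla ψ ζ = ∑ z : _ × Fin (k + 1), (√(prodDist r p z) : ℂ) •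
      tensorVec (tensorVec (u z.1) (e z.2)) (tensorVec (v z.1) (e z.2)) := by
    conv_lhs => rw [hψ]
    simp only [ζ]
    rw [withAncilla_sum_sum]
    refine Finset.sum_congr rfl fun z _ => ?_
    rw [withAncilla_tensorVec, prodDist, Real.sqrt_mul (hr.nonneg _), Complex.ofReal_mul]
  have hover : inner ℂ (withAncilla ψ ζ) (act (U ⊗ₖ V) (withAncilla φ
      (EuclideanSpace.single ((0 : Fin (k + 1)), (0 : Fin (k + 1))) 1)))
      = (permOverlap r t p π : ℂ) := by
    rw [hφe, hψζ, map_sum, inner_sum]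
    have hterm : ∀ j, inner ℂ (∑ z : _ × Fin (k + 1), (√(prodDist r p z) : ℂ) •
        tensorVec (tensorVec (u z.1) (e z.2)) (tensorVec (v z.1) (e z.2)))
        (act (U ⊗ₖ V) ((√(t j) : ℂ) • tensorVec (tensorVec (u' j) (e 0)) (tensorVec (v' j) (e 0))))
        = (√(prodDist r p (y j)) : ℂ) * (√(t j) : ℂ) := by
      intro j
      rw [map_smul, act_kronecker_tensorVec, inner_smul_right, sum_inner]
      have h1 : act U (tensorVec (u' j) (e 0)) = tensorVec (u (y j).1) (e (y j).2) := hUe j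
      have h2 : act V (tensorVec (v' j) (e 0)) = tensorVec (v (y j).1) (e (y j).2) := hVe j
      rw [h1, h2, Finset.sum_eq_single (y j)]
      · rw [inner_smul_left, inner_tensorVec, orthonormal_iff_ite.mp hue (y j) (y j),
          orthonormal_iff_ite.mp hve (y j) (y j), if_pos rfl, Complex.conj_ofReal]
        ring
      · intro z _ hz
        rw [inner_smul_left, inner_tensorVec, orthonormal_iff_ite.mp hue z (y j), if_neg hz]
        ring
      · simp
    rw [Finset.sum_congr rfl fun j _ => hterm j]
    unfold permOverlap
    rw [← Equiv.sum_comp π.symm, Fintype.sum_prod_type]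
    push_cast
    refine Finset.sum_congr rfl fun j _ => ?_
    rw [Finset.sum_eq_single 0]
    · simp [embedDist, y]
    · intro s _ hs
      simp [embedDist, hs]
    · simp
  rw [fidelity_pureOp_pureOp, ← act_apply, hover, Complex.norm_real, Real.norm_eq_abs, sq_abs]

end LocalUnitary

/-! ### Averaging over shared randomness -/

section SharedRandomness

variable {ι : Type*} [Fintype ι] [DecidableEq ι]

/-- With `A = QQ†`, entries are inner products of rows of `Q`, and the trace is the sum of their
squared norms. This bounds channel outputs uniformly, hence gives integrability. -/
theorem _root_.Matrix.PosSemidef.norm_apply_le_trace {A : Matrix ι ι ℂ} (hA : A.PosSemidef)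
    (i j : ι) : ‖A i j‖ ≤ A.trace.re := by
  let Q := psdSqrt A
  have hQ : ∀ x y, A x y = ∑ z, Q x z * star (Q y z) := by
    intro x y
    rw [← psdSqrt_mul_self hA, Matrix.mul_apply]
    refine Finset.sum_congr rfl fun z _ => ?_
    rw [← (psdSqrt_isHermitian A).apply z y]
  have htr : A.trace.re = ∑ x, ∑ z, ‖Q x z‖ ^ 2 := by
    rw [Matrix.trace, Complex.re_sum]
    refine Finset.sum_congr rfl fun x _ => ?_
    rw [Matrix.diag_apply, hQ, Complex.re_sum]
    refine Finset.sum_congr rfl fun z _ => ?_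
    rw [← Complex.normSq_eq_norm_sq, Complex.normSq_apply]
    simp
  have hle : ∀ x, ∑ z, ‖Q x z‖ ^ 2 ≤ A.trace.re := by
    intro x
    rw [htr]
    exact Finset.single_le_sum (f := fun x => ∑ z, ‖Q x z‖ ^ 2)
      (fun x _ => Finset.sum_nonneg fun z _ => sq_nonneg _) (Finset.mem_univ x)
  calc ‖A i j‖ ≤ ∑ z, ‖Q i z‖ * ‖Q j z‖ := by
        rw [hQ]
        refine (norm_sum_le _ _).trans (Finset.sum_le_sum fun z _ => ?_)
        rw [norm_mul, norm_star]
    _ ≤ ∑ z, (‖Q i z‖ ^ 2 + ‖Q j z‖ ^ 2) / 2 := Finset.sum_le_sum fun z _ => by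
        nlinarith [sq_nonneg (‖Q i z‖ - ‖Q j z‖)]
    _ ≤ A.trace.re := by
        rw [← Finset.sum_div, Finset.sum_add_distrib]
        linarith [hle i, hle j]

omit [DecidableEq ι] in
theorem star_dotProduct_integral_mulVec {S : Type*} [MeasurableSpace S]
    {μ : MeasureTheory.Measure S} {T : S → Matrix ι ι ℂ}
    (hT : ∀ i j, MeasureTheory.Integrable (fun s => T s i j) μ) (χ : ι → ℂ) :
    star χ ⬝ᵥ (Matrix.of fun i j => ∫ s, T s i j ∂μ).mulVec χ
      = ∫ s, star χ ⬝ᵥ (T s).mulVec χ ∂μ := by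
  simp only [dotProduct, Matrix.mulVec, Matrix.of_apply, Finset.mul_sum]
  have hint : ∀ i j, MeasureTheory.Integrable (fun s => star χ i * (T s i j * χ j)) μ :=
    fun i j => ((hT i j).mul_const _).const_mul _
  rw [MeasureTheory.integral_finsetSum _ fun i _ =>
    MeasureTheory.integrable_finsetSum _ fun j _ => hint i j]
  refine Finset.sum_congr rfl fun i _ => ?_
  rw [MeasureTheory.integral_finsetSum _ fun j _ => hint i j]
  refine Finset.sum_congr rfl fun j _ => ?_
  rw [MeasureTheory.integral_const_mul, MeasureTheory.integral_mul_const]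

/-- Quadratic forms commute with the entrywise integral. This shows that the averaged operator is
positive semidefinite, and then that the fidelity averages. -/
theorem fidelity_pureOp_integral {S : Type*} [MeasurableSpace S] {μ : MeasureTheory.Measure S}
    {T : S → Matrix ι ι ℂ} (hT : ∀ i j, MeasureTheory.Integrable (fun s => T s i j) μ)
    (hpos : ∀ s, (T s).PosSemidef) (χ : EuclideanSpace ℂ ι) :
    fidelity (pureOp χ) (Matrix.of fun i j => ∫ s, T s i j ∂μ)
      = ∫ s, fidelity (pureOp χ) (T s) ∂μ := by
  have hreal : ∀ (χ : ι → ℂ) s, star χ ⬝ᵥ (T s).mulVec χ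
      = ((star χ ⬝ᵥ (T s).mulVec χ).re : ℂ) := by
    intro χ s
    have him := (Complex.nonneg_iff.mp ((hpos s).dotProduct_mulVec_nonneg χ)).2
    exact Complex.ext rfl (him.symm.trans (Complex.ofReal_im _).symm)
  have hquad : ∀ χ : ι → ℂ, star χ ⬝ᵥ (Matrix.of fun i j => ∫ s, T s i j ∂μ).mulVec χ
      = ((∫ s, (star χ ⬝ᵥ (T s).mulVec χ).re ∂μ : ℝ) : ℂ) := by
    intro χ
    rw [star_dotProduct_integral_mulVec hT, ← integral_complex_ofReal]
    exact MeasureTheory.integral_congr_ae (.of_forall fun s => hreal χ s)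
  have hM : (Matrix.of fun i j => ∫ s, T s i j ∂μ).PosSemidef := by
    rw [Matrix.posSemidef_iff_dotProduct_mulVec]
    refine ⟨?_, fun χ => ?_⟩
    · ext i j
      rw [Matrix.conjTranspose_apply, Matrix.of_apply, Matrix.of_apply, RCLike.star_def,
        ← integral_conj]
      refine MeasureTheory.integral_congr_ae (.of_forall fun s => ?_)
      exact (hpos s).isHermitian.apply i j
    · rw [hquad, Complex.zero_le_real]
      refine MeasureTheory.integral_nonneg fun s => ?_
      exact (Complex.nonneg_iff.mp ((hpos s).dotProduct_mulVec_nonneg χ)).1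
  rw [fidelity_pureOp hM, expVal, hquad, Complex.ofReal_re]
  refine MeasureTheory.integral_congr_ae (.of_forall fun s => ?_)
  exact (fidelity_pureOp (hpos s) χ).symm

variable {a b : Type*} [Fintype a] [DecidableEq a] [Fintype b] [DecidableEq b]

theorem fidelitiesLO_subset_fidelitiesLOSR (ρ σ : Matrix (a × b) (a × b) ℂ) :
    fidelitiesLO ρ σ ⊆ fidelitiesLOSR ρ σ := by
  rintro _ ⟨E, F, hE, hF, rfl⟩
  refine ⟨Unit, inferInstance, MeasureTheory.Measure.dirac (), fun _ => E, fun _ => F,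
    inferInstance, fun _ => hE, fun _ => hF, fun _ _ _ => measurable_const,
    fun _ _ _ => measurable_const, ?_⟩
  congr 1
  ext p q
  simp

theorem mem_upperBounds_fidelitiesLOSR {ψ φ : EuclideanSpace ℂ (a × b)} {x : ℝ}
    (hx : x ∈ upperBounds (fidelitiesLO (pureOp ψ) (pureOp φ))) :
    x ∈ upperBounds (fidelitiesLOSR (pureOp ψ) (pureOp φ)) := by
  rintro _ ⟨S, _, μ, E, F, _, hE, hF, hEm, hFm, rfl⟩
  have hpos : ∀ s, (tensorMap (E s) (F s) (pureOp φ)).PosSemidef := fun s =>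
    (hE s).tensorMap_posSemidef (hF s) (pureOp_posSemidef φ)
  have hint : ∀ p q, MeasureTheory.Integrable
      (fun s => tensorMap (E s) (F s) (pureOp φ) p q) μ := by
    intro p q
    refine MeasureTheory.Integrable.of_bound (C := (pureOp φ).trace.re) ?_
      (.of_forall fun s => ?_)
    · refine Measurable.aestronglyMeasurable ?_
      simp only [tensorMap, Matrix.sum_apply, Matrix.smul_apply, Matrix.kroneckerMap_apply]
      fun_prop (disch := assumption)
    · rw [← (hE s).trace_tensorMap (hF s)]
      exact (hpos s).norm_apply_le_trace p q
  rw [fidelity_pureOp_integral hint hpos]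
  have hle : ∀ s, fidelity (pureOp ψ) (tensorMap (E s) (F s) (pureOp φ)) ≤ x := fun s =>
    hx ⟨E s, F s, hE s, hF s, rfl⟩
  calc _ ≤ ∫ _, x ∂μ := MeasureTheory.integral_mono_of_nonneg
        (.of_forall fun s => sq_nonneg _) (MeasureTheory.integrable_const x) (.of_forall hle)
    _ = x := by simp

end SharedRandomness

end LocalConversion

end

theorem mainTheorem2 {a b : Type*} [Fintype a] [DecidableEq a] [Fintype b] [DecidableEq b]
    (ψ φ : EuclideanSpace ℂ (a × b)) (hψ : ψ ≠ 0) (hφ : φ ≠ 0)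
    (r t : Fin (min (Fintype.card a) (Fintype.card b)) → ℝ)
    (hr : IsSchmidt ψ r) (ht : IsSchmidt φ t) :
    ∃ Fopt : ℝ,
      IsGreatest (fidelitiesLOSR (pureOp ψ) (pureOp φ)) Fopt ∧
      IsGreatest (fidelitiesLO (pureOp ψ) (pureOp φ)) Fopt ∧
      IsGreatest {x | ∃ k ≤ schmidtRank t * schmidtRank r, x ∈ reorderedFidelities r t k} Fopt ∧
      (∀ k, schmidtRank t * schmidtRank r ≤ k → IsGreatest (reorderedFidelities r t k) Fopt) ∧
      IsGreatest (fidelitiesLUAncilla ψ φ) Fopt := by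
  obtain ⟨x, hx, hub⟩ := exists_reordered_maximum hr.nonneg ht.nonneg (ht.ne_zero hφ)
  have hr1 : 0 < schmidtRank r := schmidtRank_pos (hr.ne_zero hψ)
  have ht1 : 0 < schmidtRank t := schmidtRank_pos (ht.ne_zero hφ)
  have hle : schmidtRank t ≤ schmidtRank t * schmidtRank r := Nat.le_mul_of_pos_right _ hr1
  have hLU : x ∈ fidelitiesLUAncilla ψ φ := by
    -- Ancillas have dimension `k + 1`; here this equals `schmidtRank t`.
    obtain ⟨k, hk⟩ := Nat.exists_eq_succ_of_ne_zero ht1.ne'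
    obtain ⟨p, hp, h⟩ := (hx (k + 1) hk.le).1
    rw [fidelity_sortDesc hr.nonneg ht.nonneg hp.1] at h
    rw [h]
    exact permOverlap_sq_mem_fidelitiesLUAncilla hr ht hp _
  have hx0 : 0 ≤ x := by
    obtain ⟨p, -, h⟩ := (hx _ le_rfl).1
    rw [h]
    exact sq_nonneg _
  have hLOub : x ∈ upperBounds (fidelitiesLO (pureOp ψ) (pureOp φ)) := by
    rintro _ ⟨E, F, hE, hF, rfl⟩
    obtain ⟨k, W, hW, rfl⟩ := hE.exists_isometry
    obtain ⟨l, V, hV, rfl⟩ := hF.exists_isometry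
    rw [fidelity_tensorMap_krausMap]
    exact norm_sq_amplitude_le hr ht hx0 hub hW hV
  have hLO : IsGreatest (fidelitiesLO (pureOp ψ) (pureOp φ)) x := by
    obtain ⟨y, hy, hxy⟩ := exists_fidelitiesLO_ge hLU
    -- The channel value `y` lies between `x` and the upper bound `x`, so `x` is attained.
    exact ⟨le_antisymm hxy (hLOub hy) ▸ hy, hLOub⟩
  refine ⟨x, ⟨fidelitiesLO_subset_fidelitiesLOSR _ _ hLO.1, mem_upperBounds_fidelitiesLOSR hLOub⟩,
    hLO, ⟨⟨_, le_rfl, (hx _ hle).1⟩, ?_⟩, fun k hk => hx k (hle.trans hk), hLU, ?_⟩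
  · rintro y ⟨k, -, hy⟩
    obtain ⟨p, hp, P, hP, rfl⟩ := exists_matchingOverlap_of_mem hr.nonneg ht.nonneg hy
    exact hub _ p P hp hP
  · intro y hy
    obtain ⟨z, hz, hyz⟩ := exists_fidelitiesLO_ge hy
    exact hyz.trans (hLOub hz)
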